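/- Let $X\subseteq\mathbb R^d$, $Y\subseteq\mathbb R^n$ be closed convex sets and $f:X\times Y\to\mathbb R$ continuous, with $f(\cdot,y)$ $\rho$-weakly convex on $X$ for every $y\in Y$ (i.e. $f(\cdot,y)+\frac{\rho}{2}\|\cdot\|^2$ is convex) and $f(x,\cdot)$ $\lambda$-strongly concave on $Y$ for every $x\in X$, where $\rho,\lambda>0$. Put $P(x)=\max_{y\in Y}f(x,y)$ for $x\in X$ and let $\partial$ denote the limiting (Fréchet) subdifferential of a function with domain $X$ (or $Y$), i.e. of its extension by $+\infty$. A stochastic oracle returns, at $(x,y)\in X\times Y$ and for a random sample $\xi$, vectors $\mathcal G_x(x,y;\xi)$, $\mathcal G_y(x,y;\xi)$ with $\mathrm E[\mathcal G_x(x,y;\xi)]\in\partial_x f(x,y)$, $-\mathrm E[\mathcal G_y(x,y;\xi)]\in\partial_y(-f)(x,y)$, $\mathrm E\|\mathcal G_x(x,y;\xi)\|^2\le M_1^2$ and $\mathrm E\|\mathcal G_y(x,y;\xi)\|^2\le M_2^2$. Let $(x_0,y_0)\in X\times Y$ and $\epsilon_0>0$ satisfy $\mathrm{Gap}(x_0,y_0)=\sup_{y\in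 Y}f(x_0,y)-\inf_{x\in X}f(x,y_0)\le\epsilon_0$. Epoch-GDA: let $\gamma=2\rho$, $(x_0^1,y_0^1)=(x_0,y_0)$. In epoch $k=1,2,\dots$ put $T_k=\lceil 106(k+1)/3\rceil$, $\eta_x^k=\frac{4}{\rho(k+1)}$, $\eta_y^k=\frac{2}{\lambda(k+1)}$; for $t=0,\dots,T_k-1$ draw a fresh independent sample $\xi_t^k$ and set $$x_{t+1}^k=\arg\min_{x\in X}\ x^\top\mathcal G_x(x_t^k,y_t^k;\xi_t^k)+\tfrac{1}{2\eta_x^k}\|x-x_t^k\|^2+\tfrac{\gamma}{2}\|x-x_0^k\|^2,\qquad y_{t+1}^k=\arg\min_{y\in Y}\ -y^\top\mathcal G_y(x_t^k,y_t^k;\xi_t^k)+\tfrac{1}{2\eta_y^k}\|y-y_t^k\|^2;$$ then $(x_0^{k+1},y_0^{k+1})=\frac1{T_k}\sum_{t=0}^{T_k-1}(x_t^k,y_t^k)$. Then for every $k\ge1$ the function $\hat f_k(x,y)=f(x,y)+\frac{\gamma}{2}\|x-x_0^k\|^2$ has a unique saddle point $(\hat x_k^*,\hat y_k^*)$ on $X\times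 Y$ (minimizing in $x$, maximizing in $y$). For $\epsilon>0$ let $a(\epsilon)=\frac{1696\gamma}{\epsilon^2}\left(\frac{2M_1^2}{\rho}+\frac{M_2^2}{\lambda}\right)$ and let $K(\epsilon)=\max\left\{1,\ \left\lceil\max\left\{a(\epsilon)\ln a(\epsilon),\ \frac{1376\,\gamma\,\epsilon_0}{5\epsilon^2}\right\}\right\rceil\right\}$, where $0\ln0=0$. If $K\ge K(\epsilon)$ is an integer and $\tau$ is uniformly distributed on $\{1,\dots,K\}$, independently of the samples, then $$\mathrm E\big[\mathrm{dist}(0,\partial P(\hat x_\tau^*))^2\big]\ \le\ \gamma^2\,\mathrm E\|\hat x_\tau^*-x_0^\tau\|^2\ \le\ \epsilon^2 .$$ Hence $x_0^\tau$ is nearly $\epsilon$-stationary for $\min_{x\in X}P(x)$ in mean square: there is a random $z$ with $\mathrm E\|z-x_0^\tau\|^2\le(\epsilon/\gamma)^2$ and $\mathrm E[\mathrm{dist}(0,\partial P(z))^2]\le\epsilon^2$. The total number of iterations is $\sum_{k=1}^{K(\epsilon)}T_k=O\big(\epsilon^{-4}\ln^2(1/\epsilon)\big)=\tilde O(\epsilon^{-4})$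 as $\epsilon\to0^+$, all other parameters being fixed. -/

import Mathlib

open MeasureTheory ProbabilityTheory Filter Topology

noncomputable section

/-- `g` is `ρ`-weakly convex on `s`: `g + (ρ / 2) ‖·‖²` is convex on `s`. -/
def WeaklyConvexOn {E : Type*} [NormedAddCommGroup E] [InnerProductSpace ℝ E]
    (s : Set E) (ρ : ℝ) (g : E → ℝ) : Prop :=
  ConvexOn ℝ s fun x => g x + ρ / 2 * ‖x‖ ^ 2

/-- Fréchet subdifferential at `x` of a function `g` whose domain is `s` (equivalently, of `g`
extended by `+∞` outside `s`): all `v` such that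
`liminf (g z - g x - ⟪v, z - x⟫) / ‖z - x‖ ≥ 0` as `z → x` in `s`. -/
def frechetSubdiff {E : Type*} [NormedAddCommGroup E] [InnerProductSpace ℝ E]
    (s : Set E) (g : E → ℝ) (x : E) : Set E :=
  {v | x ∈ s ∧ ∀ c > 0, ∀ᶠ z in 𝓝[s] x, -(c * ‖z - x‖) ≤ g z - g x - inner ℝ v (z - x)}

/-- Limiting subdifferential at `x` of a function `g` whose domain is `s`: limits of Fréchet
subgradients at points `u n → x` with `g (u n) → g x`. -/
def limitingSubdiff {E : Type*} [NormedAddCommGroup E] [InnerProductSpace ℝ E]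
    (s : Set E) (g : E → ℝ) (x : E) : Set E :=
  {v | x ∈ s ∧ ∃ u w : ℕ → E, (∀ n, w n ∈ frechetSubdiff s g (u n)) ∧
    Tendsto u atTop (𝓝 x) ∧ Tendsto (fun n => g (u n)) atTop (𝓝 (g x)) ∧
    Tendsto w atTop (𝓝 v)}

/-- The primal objective `P(x) = max_{y ∈ Y} f(x, y)`. -/
def primalObj {E F : Type*} (Y : Set F) (f : E → F → ℝ) (x : E) : ℝ :=
  sSup (f x '' Y)

/-- The duality gap `max_{y' ∈ Y} f(x, y') - min_{x' ∈ X} f(x', y)`, as an extended real. -/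
def dualityGap {E F : Type*} (X : Set E) (Y : Set F) (f : E → F → ℝ) (x : E) (y : F) : EReal :=
  (⨆ y' ∈ Y, (f x y' : EReal)) - ⨅ x' ∈ X, (f x' y : EReal)

/-- A minimizer of `g` over `s` (an arbitrary point if there is none). -/
def argMinOver {E : Type*} [Nonempty E] (s : Set E) (g : E → ℝ) : E :=
  Classical.epsilon fun x => x ∈ s ∧ IsMinOn g s x

/-- `p` is a point of `X × Y` and a saddle point of `g` there:
`g(p.1, y) ≤ g(p.1, p.2) ≤ g(x, p.2)` for all `x ∈ X`, `y ∈ Y`. -/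
def IsSaddle {E F : Type*} (X : Set E) (Y : Set F) (g : E → F → ℝ) (p : E × F) : Prop :=
  p.1 ∈ X ∧ p.2 ∈ Y ∧ IsSaddlePointOn X Y g p.1 p.2

/-- The saddle point of `g` on `X × Y` (an arbitrary point if there is none). -/
def saddlePoint {E F : Type*} [Nonempty E] [Nonempty F] (X : Set E) (Y : Set F)
    (g : E → F → ℝ) : E × F :=
  Classical.epsilon (IsSaddle X Y g)

/-- The regularized objective `f(x, y) + (γ / 2) ‖x - c‖²` with prox center `c`. -/
def regObj {E F : Type*} [NormedAddCommGroup E] (γ : ℝ) (c : E) (f : E → F → ℝ)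
    (x : E) (y : F) : ℝ :=
  f x y + γ / 2 * ‖x - c‖ ^ 2

/-- The number of inner iterations of epoch `k ≥ 1`: `106 (k + 1) / 3`, rounded up. -/
def epochLen (k : ℕ) : ℕ := ⌈(106 * ((k : ℝ) + 1) / 3 : ℝ)⌉₊

section Algorithm

variable {E F S : Type*} [NormedAddCommGroup E] [InnerProductSpace ℝ E]
  [NormedAddCommGroup F] [InnerProductSpace ℝ F]

/-- One primal-dual update from the point `p`, with prox center `c`, step sizes `ηx`, `ηy` and
the stochastic subgradients `Gx`, `Gy` evaluated at `p` and at the sample `s`. -/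
def gdaStep (X : Set E) (Y : Set F) (Gx : E → F → S → E) (Gy : E → F → S → F)
    (γ ηx ηy : ℝ) (c : E) (p : E × F) (s : S) : E × F :=
  (argMinOver X fun x =>
      inner ℝ x (Gx p.1 p.2 s) + 1 / (2 * ηx) * ‖x - p.1‖ ^ 2 + γ / 2 * ‖x - c‖ ^ 2,
   argMinOver Y fun y =>
      -inner ℝ y (Gy p.1 p.2 s) + 1 / (2 * ηy) * ‖y - p.2‖ ^ 2)

/-- The inner iterates `(x_t, y_t)`, `t = 0, 1, …`, of epoch `k`, which starts at `p₀`, has the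
prox center `p₀.1`, the step sizes `4 / (ρ (k + 1))` and `2 / (lam (k + 1))`, and uses the sample
`s t` in the update from `t` to `t + 1`. -/
def epochIter (X : Set E) (Y : Set F) (Gx : E → F → S → E) (Gy : E → F → S → F)
    (γ ρ lam : ℝ) (k : ℕ) (p₀ : E × F) (s : ℕ → S) : ℕ → E × F
  | 0 => p₀
  | t + 1 => gdaStep X Y Gx Gy γ (4 / (ρ * ((k : ℝ) + 1))) (2 / (lam * ((k : ℝ) + 1))) p₀.1
      (epochIter X Y Gx Gy γ ρ lam k p₀ s t) (s t)

/-- The starting point `(x_0^k, y_0^k)` of epoch `k ≥ 1` (the value at `k = 0` is not used):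
the initial point for `k = 1`, and for `k + 2` the average of the iterates
`t = 0, …, T_{k+1} - 1` of epoch `k + 1`. The sample used in epoch `k` at step `t` is `s k t`. -/
def epochStart (X : Set E) (Y : Set F) (Gx : E → F → S → E) (Gy : E → F → S → F)
    (γ ρ lam : ℝ) (p₀ : E × F) (s : ℕ → ℕ → S) : ℕ → E × F
  | 0 => p₀
  | 1 => p₀
  | k + 2 => (epochLen (k + 1) : ℝ)⁻¹ • ∑ t ∈ Finset.range (epochLen (k + 1)),
      epochIter X Y Gx Gy γ ρ lam (k + 1)
        (epochStart X Y Gx Gy γ ρ lam p₀ s (k + 1)) (s (k + 1)) t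

end Algorithm

/-- The real number whose round-up is the prescribed number of epochs. -/
def epochBound (γ ρ lam M₁ M₂ ε₀ ε : ℝ) : ℝ :=
  max (1696 * γ * (2 * M₁ ^ 2 / ρ + M₂ ^ 2 / lam) / ε ^ 2 *
        Real.log (1696 * γ * (2 * M₁ ^ 2 / ρ + M₂ ^ 2 / lam) / ε ^ 2))
    (1376 * γ * ε₀ / (5 * ε ^ 2))

/-- The prescribed number of epochs: `epochBound` rounded up, and at least one. -/
def numEpochs (γ ρ lam M₁ M₂ ε₀ ε : ℝ) : ℕ :=
  max 1 ⌈epochBound γ ρ lam M₁ M₂ ε₀ ε⌉₊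

/-- The random point `x` is, in mean square, nearly `ε`-stationary for minimizing `ψ` over `s`,
with constant `c`: some random `z` satisfies `E ‖z - x‖² ≤ (c ε)²` and
`E dist(0, ∂ψ(z))² ≤ ε²`. (The distance to the empty set is infinite.) -/
def NearlyStationaryInMean {Ω E : Type*} [MeasurableSpace Ω]
    [NormedAddCommGroup E] [InnerProductSpace ℝ E] [MeasurableSpace E]
    (μ : Measure Ω) (s : Set E) (ψ : E → ℝ) (c ε : ℝ) (x : Ω → E) : Prop :=
  ∃ z : Ω → E, Measurable z ∧
    ∫⁻ ω, ‖z ω - x ω‖ₑ ^ 2 ∂μ ≤ ENNReal.ofReal ((c * ε) ^ 2) ∧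
    ∫⁻ ω, Metric.infEDist 0 (limitingSubdiff s ψ (z ω)) ^ 2 ∂μ ≤ ENNReal.ofReal (ε ^ 2)

end

noncomputable section

/-! Write `c k` for the prox center of epoch `k` and `p k` for the primal part of the saddle point
of the problem regularized around it. Adding `ρ ‖x - c‖ ^ 2` turns `ρ`-weak convexity into
`ρ`-strong convexity, so a unique saddle point exists, and `p k` minimizes `P + ρ ‖· - c k‖ ^ 2`.
Its optimality condition puts `2ρ (c k - p k)` into `∂P(p k)`. Stationarity therefore reduces to
bounding the average of `E ‖p k - c k‖ ^ 2`.

Two inequalities, valid for every outcome of the samples, give this bound. By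
`saddleGap_average_le`, one epoch shrinks the gap of its own regularized problem to a tenth, up to
noise. By `saddleGap_recenter_le`, the gap reached controls three things at once: a tenth of the gap
after recentering, `4/5` of the change of `P`, and `2/5 ρ ‖p k - c k‖ ^ 2`. Hence `1/10 gap + 4/5 P`
is a potential, and the inequalities telescope in `sum_sq_dist_proximal_le`. The initial gap pays
`1/10 ε₀` for the first gap and `4/5 ε₀` for the total decrease of `P`.

The delicate point in an epoch is that the gap of the average is attained at best responses, which
depend on all samples of that epoch. The noise tested against them is not centered. It is split off
by Young's inequality, leaving the squared norm of a sum of martingale differences, which grows only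
linearly in the number of steps by orthogonality (`integral_proxNoise_le`). The remaining distance
from the best responses to the starting point is bounded by gaps through strong convexity, so
neither set has to be bounded.

Since the step sizes decay like `1 / (k + 1)`, the expected noise of epoch `k` is a constant times
`1 / (k + 1)`. Its sum is logarithmic in the number of epochs, and `K ≥ a log a` makes the average
small. Independence of `τ` from the samples turns the expectation at a random epoch into the average
over epochs. Epoch lengths are linear in `k`, so the iteration count is quadratic in the number of
epochs. -/

lemma primalObj_eq_of_isMaxOn {E F : Type*} {Y : Set F} {h : E → F → ℝ} {x : E} {y : F} (hy : y ∈ Y)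
    (hmax : IsMaxOn (h x) Y y) : primalObj Y h x = h x y :=
  IsGreatest.csSup_eq ⟨⟨y, hy, rfl⟩, by rintro _ ⟨z, hz, rfl⟩; exact hmax hz⟩

lemma IsSaddle.primalObj_eq {E F : Type*} {X : Set E} {Y : Set F} {h : E → F → ℝ} {p : E × F}
    (hp : IsSaddle X Y h p) : primalObj Y h p.1 = h p.1 p.2 :=
  primalObj_eq_of_isMaxOn hp.2.1 fun y hy => hp.2.2 p.1 hp.1 y hy

/-! ### Strongly convex functions and existence of saddle points -/

section StrongConvexity

variable {E F : Type*} [NormedAddCommGroup E] [InnerProductSpace ℝ E]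
  [NormedAddCommGroup F] [InnerProductSpace ℝ F]

/-- Replaces the limit `t → 0`: if `b < a`, the choice `t = (a - b) / (2a)` turns `(1 - t) a` into
the midpoint of `a` and `b`, which exceeds `b`. -/
lemma le_of_forall_one_sub_mul_le {a b : ℝ} (h : ∀ t : ℝ, 0 < t → t ≤ 1 → (1 - t) * a ≤ b) :
    a ≤ b := by
  have hb : 0 ≤ b := by simpa using h 1 one_pos le_rfl
  by_contra! hab
  have ha : 0 < a := hb.trans_lt hab
  have h1 := h ((a - b) / (2 * a)) (by have := sub_pos.2 hab; positivity)
    (by rw [div_le_one (by positivity)]; linarith)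
  have h2 : (1 - (a - b) / (2 * a)) * a = (a + b) / 2 := by field_simp; ring
  linarith

/-- Quadratic growth of a strongly convex function away from a minimizer. -/
lemma StrongConvexOn.add_le_of_isMinOn {s : Set E} {m : ℝ} {g : E → ℝ}
    (hg : StrongConvexOn s m g) {x : E} (hx : x ∈ s) (hmin : IsMinOn g s x) {z : E} (hz : z ∈ s) :
    g x + m / 2 * ‖z - x‖ ^ 2 ≤ g z := by
  suffices h : m / 2 * ‖z - x‖ ^ 2 ≤ g z - g x by linarith
  refine le_of_forall_one_sub_mul_le fun t ht0 ht1 => ?_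
  have hmem : (1 - t) • x + t • z ∈ s := hg.1 hx hz (by linarith) ht0.le (by ring)
  have h1 : g x ≤ g ((1 - t) • x + t • z) := hmin hmem
  have h2 := hg.2 hx hz (by linarith : (0 : ℝ) ≤ 1 - t) ht0.le (by ring)
  simp only [smul_eq_mul] at h2
  rw [norm_sub_rev x z] at h2
  have h3 : t * ((1 - t) * (m / 2 * ‖z - x‖ ^ 2)) ≤ t * (g z - g x) := by linarith
  exact le_of_mul_le_mul_left h3 ht0

lemma StrongConcaveOn.le_of_isMaxOn {s : Set E} {m : ℝ} {g : E → ℝ}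
    (hg : StrongConcaveOn s m g) {x : E} (hx : x ∈ s) (hmax : IsMaxOn g s x) {z : E} (hz : z ∈ s) :
    g z + m / 2 * ‖z - x‖ ^ 2 ≤ g x := by
  have h : StrongConvexOn s m (-g) := UniformConcaveOn.neg hg
  have := h.add_le_of_isMinOn hx hmax.neg hz
  simp only [Pi.neg_apply] at this
  linarith

lemma StrongConvexOn.eq_of_isMinOn {s : Set E} {m : ℝ} {g : E → ℝ} (hm : 0 < m)
    (hg : StrongConvexOn s m g) {x z : E} (hx : x ∈ s) (hxmin : IsMinOn g s x)
    (hz : z ∈ s) (hzmin : IsMinOn g s z) : x = z :=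
  (hg.strictConvexOn hm).eq_of_isMinOn hxmin hzmin hx hz

/-- A lower semicontinuous strongly convex function attains its minimum on a closed set. -/
lemma StrongConvexOn.exists_isMinOn [ProperSpace E] {s : Set E} {m : ℝ} {g : E → ℝ} (hm : 0 < m)
    (hg : StrongConvexOn s m g) (hs : IsClosed s) (hne : s.Nonempty)
    (hlsc : LowerSemicontinuousOn g s) : ∃ x ∈ s, IsMinOn g s x := by
  obtain ⟨x₀, hx₀⟩ := hne
  have hcpt : ∀ R, IsCompact (s ∩ Metric.closedBall x₀ R) := fun R =>
    (isCompact_closedBall x₀ R).inter_left hs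
  obtain ⟨w, -, hwmin⟩ := (hlsc.mono Set.inter_subset_left).exists_isMinOn
    (s := s ∩ Metric.closedBall x₀ 1) ⟨x₀, hx₀, by simp⟩ (hcpt 1)
  have hw0 : g w ≤ g x₀ := hwmin ⟨hx₀, by simp⟩
  -- For `z` at distance `r > 1` from `x₀`, the segment meets the unit sphere around `x₀` at a point
  -- of value at least `g w`. Strong convexity then gives `g z ≥ g x₀ + r ((r - 1) m / 2 - (g x₀ - g
  -- w))`, and this `R` makes the bracket nonnegative for `r > R`.
  set R := 1 + 2 * (g x₀ - g w) / m with hR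
  have hR1 : 1 ≤ R := by
    have : 0 ≤ 2 * (g x₀ - g w) / m := div_nonneg (by linarith) hm.le
    linarith
  obtain ⟨x, hx, hxmin⟩ := (hlsc.mono Set.inter_subset_left).exists_isMinOn
    (s := s ∩ Metric.closedBall x₀ R) ⟨x₀, hx₀, by simp; linarith⟩ (hcpt R)
  refine ⟨x, hx.1, fun z hz => ?_⟩
  by_cases hzR : ‖z - x₀‖ ≤ R
  · exact hxmin ⟨hz, by simpa [dist_eq_norm] using hzR⟩
  have hx0 : g x ≤ g x₀ := hxmin ⟨hx₀, by simp; linarith⟩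
  refine hx0.trans ?_
  push Not at hzR
  set r := ‖z - x₀‖ with hr
  have hr1 : 1 < r := by linarith
  have hr0 : 0 < r := by linarith
  have hinv : r⁻¹ ≤ 1 := inv_le_one_of_one_le₀ hr1.le
  have h2 := hg.2 hx₀ hz (by linarith : (0 : ℝ) ≤ 1 - r⁻¹)
    (by positivity : 0 ≤ r⁻¹) (by ring)
  have hmem : (1 - r⁻¹) • x₀ + r⁻¹ • z ∈ s ∩ Metric.closedBall x₀ 1 := by
    refine ⟨hg.1 hx₀ hz (by linarith) (by positivity) (by ring), ?_⟩
    have : (1 - r⁻¹) • x₀ + r⁻¹ • z - x₀ = r⁻¹ • (z - x₀) := by module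
    rw [Metric.mem_closedBall, dist_eq_norm, this, norm_smul, ← hr, Real.norm_of_nonneg
      (by positivity), inv_mul_cancel₀ hr0.ne']
  have h3 : g w ≤ g ((1 - r⁻¹) • x₀ + r⁻¹ • z) := hwmin hmem
  rw [norm_sub_rev x₀ z, ← hr] at h2
  simp only [smul_eq_mul] at h2
  have h4 : r * g w ≤ r * ((1 - r⁻¹) * g x₀ + r⁻¹ * g z - (1 - r⁻¹) * r⁻¹ * (m / 2 * r ^ 2)) :=
    mul_le_mul_of_nonneg_left (h3.trans h2) hr0.le
  have h5 : r * ((1 - r⁻¹) * g x₀ + r⁻¹ * g z - (1 - r⁻¹) * r⁻¹ * (m / 2 * r ^ 2))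
      = (r - 1) * g x₀ + g z - (r - 1) * (m / 2 * r) := by field_simp
  have h6 : 2 * (g x₀ - g w) ≤ (r - 1) * m := by
    have : 2 * (g x₀ - g w) / m ≤ r - 1 := by linarith
    rwa [div_le_iff₀ hm] at this
  nlinarith

lemma StrongConcaveOn.exists_isMaxOn [ProperSpace E] {s : Set E} {m : ℝ} {g : E → ℝ} (hm : 0 < m)
    (hg : StrongConcaveOn s m g) (hs : IsClosed s) (hne : s.Nonempty)
    (hcont : ContinuousOn g s) : ∃ x ∈ s, IsMaxOn g s x := by
  have h : StrongConvexOn s m (-g) := UniformConcaveOn.neg hg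
  obtain ⟨x, hx, hmin⟩ := h.exists_isMinOn hm hs hne hcont.neg.lowerSemicontinuousOn
  exact ⟨x, hx, by simpa using hmin.neg⟩

/-- A strongly convex, strongly concave function on a product of closed convex sets that is
separately continuous. -/
structure StrongConvexConcave (X : Set E) (Y : Set F) (m l : ℝ) (h : E → F → ℝ) : Prop where
  closed_left : IsClosed X
  closed_right : IsClosed Y
  nonempty_left : X.Nonempty
  nonempty_right : Y.Nonempty
  pos_left : 0 < m
  pos_right : 0 < l
  convex : ∀ y ∈ Y, StrongConvexOn X m fun x => h x y
  concave : ∀ x ∈ X, StrongConcaveOn Y l (h x)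
  cont_left : ∀ y ∈ Y, ContinuousOn (fun x => h x y) X
  cont_right : ∀ x ∈ X, ContinuousOn (h x) Y

namespace StrongConvexConcave

variable {X : Set E} {Y : Set F} {m l : ℝ} {h : E → F → ℝ}

lemma exists_isMaxOn [ProperSpace F] (H : StrongConvexConcave X Y m l h) {x : E} (hx : x ∈ X) :
    ∃ y ∈ Y, IsMaxOn (h x) Y y :=
  (H.concave x hx).exists_isMaxOn H.pos_right H.closed_right H.nonempty_right (H.cont_right x hx)

lemma exists_isMinOn [ProperSpace E] (H : StrongConvexConcave X Y m l h) {y : F} (hy : y ∈ Y) :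
    ∃ x ∈ X, IsMinOn (fun x => h x y) X x :=
  (H.convex y hy).exists_isMinOn H.pos_left H.closed_left H.nonempty_left
    (H.cont_left y hy).lowerSemicontinuousOn

lemma le_primalObj [ProperSpace F] (H : StrongConvexConcave X Y m l h) {x : E} (hx : x ∈ X)
    {y : F} (hy : y ∈ Y) : h x y ≤ primalObj Y h x := by
  obtain ⟨z, hz, hmax⟩ := H.exists_isMaxOn hx
  rw [primalObj_eq_of_isMaxOn hz hmax]
  exact hmax hy

/-- It suffices to use the strong convexity of `h(·, y)` for the one `y` that is the best response
at the convex combination. -/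
lemma strongConvexOn_primalObj [ProperSpace F] (H : StrongConvexConcave X Y m l h) :
    StrongConvexOn X m (primalObj Y h) := by
  have hX : Convex ℝ X := (H.convex _ H.nonempty_right.some_mem).1
  refine ⟨hX, fun x hx z hz a b ha hb hab => ?_⟩
  obtain ⟨y, hy, hmax⟩ := H.exists_isMaxOn (hX hx hz ha hb hab)
  rw [primalObj_eq_of_isMaxOn hy hmax]
  have h1 := (H.convex y hy).2 hx hz ha hb hab
  have h2 := H.le_primalObj hx hy
  have h3 := H.le_primalObj hz hy
  simp only [smul_eq_mul] at h1 ⊢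
  nlinarith [mul_le_mul_of_nonneg_left h2 ha, mul_le_mul_of_nonneg_left h3 hb]

lemma lowerSemicontinuousOn_primalObj [ProperSpace F] (H : StrongConvexConcave X Y m l h) :
    LowerSemicontinuousOn (primalObj Y h) X := by
  intro x hx a ha
  obtain ⟨y, hy, hmax⟩ := H.exists_isMaxOn hx
  rw [primalObj_eq_of_isMaxOn hy hmax] at ha
  filter_upwards [(H.cont_left y hy x hx).eventually (lt_mem_nhds ha), self_mem_nhdsWithin]
    with z hz hzX
  exact lt_of_lt_of_le hz (H.le_primalObj hzX hy)

lemma isMinOn_primalObj_of_isSaddle [ProperSpace F] (H : StrongConvexConcave X Y m l h)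
    {p : E × F} (hp : IsSaddle X Y h p) : IsMinOn (primalObj Y h) X p.1 := fun x hx => by
  change primalObj Y h p.1 ≤ primalObj Y h x
  rw [hp.primalObj_eq]
  exact (hp.2.2 x hx p.2 hp.2.1).trans (H.le_primalObj hx hp.2.1)

/-- A minimax theorem without compactness. Take `x'` minimizing the primal objective and its best
response `y'`. If some `x` had `h x y' < h x' y'`, move `x'` slightly towards `x`. The new best
response `y₁` stays close to `y'` by quadratic growth, while minimality of `x'` forces `h x' y' ≤ h
x y₁`. This contradicts continuity of `h x` at `y'`. -/
theorem exists_isSaddle [ProperSpace E] [ProperSpace F] (H : StrongConvexConcave X Y m l h) :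
    ∃ p, IsSaddle X Y h p := by
  obtain ⟨x', hx', hmin⟩ := H.strongConvexOn_primalObj.exists_isMinOn H.pos_left H.closed_left
    H.nonempty_left H.lowerSemicontinuousOn_primalObj
  obtain ⟨y', hy', hmax⟩ := H.exists_isMaxOn hx'
  refine ⟨(x', y'), hx', hy', fun x hx y hy => (hmax hy).trans ?_⟩
  have hP := primalObj_eq_of_isMaxOn hy' hmax
  change h x' y' ≤ h x y'
  by_contra! hlt
  obtain ⟨δ, hδ, hball⟩ := Metric.mem_nhdsWithin_iff.1
    ((H.cont_right x hx y' hy').eventually (gt_mem_nhds hlt))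
  have hC : 0 ≤ primalObj Y h x - h x' y' := by
    rw [← hP]; exact sub_nonneg.2 (hmin hx)
  set C := primalObj Y h x - h x' y' with hCdef
  have hl := H.pos_right
  -- The bound `1/2` keeps `1 - t` away from zero, giving `l ‖y₁ - y'‖ ^ 2 ≤ 4 t C`; the other bound
  -- brings this below `l δ ^ 2`. The `+ 1` covers `C = 0`.
  set t := min (1 / 2) (δ ^ 2 * l / (8 * (C + 1))) with ht
  have ht0 : 0 < t := by positivity
  have ht2 : t ≤ 1 / 2 := min_le_left _ _
  have hX : Convex ℝ X := H.strongConvexOn_primalObj.1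
  have hmem : (1 - t) • x' + t • x ∈ X := hX hx' hx (by linarith) ht0.le (by ring)
  obtain ⟨y₁, hy₁, hmax₁⟩ := H.exists_isMaxOn hmem
  have h1 : h x' y' ≤ h ((1 - t) • x' + t • x) y₁ := by
    rw [← hP, ← primalObj_eq_of_isMaxOn hy₁ hmax₁]; exact hmin hmem
  have h2 := ((H.convex y₁ hy₁).convexOn fun r => by
    have := H.pos_left; simp only [Pi.zero_apply]; positivity).2 hx' hx
      (by linarith : (0 : ℝ) ≤ 1 - t) ht0.le (by ring)
  have h3 := (H.concave x' hx').le_of_isMaxOn hy' hmax hy₁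
  have h4 := H.le_primalObj hx hy₁
  simp only [smul_eq_mul] at h2
  have hn : 0 ≤ ‖y₁ - y'‖ ^ 2 := by positivity
  have h5 : h x' y' ≤ h x y₁ := by
    have : t * h x' y' ≤ t * h x y₁ := by
      nlinarith [mul_nonneg hl.le hn]
    exact le_of_mul_le_mul_left this ht0
  have h6 : l * ‖y₁ - y'‖ ^ 2 ≤ 4 * (t * C) := by
    have h7 : (1 - t) * (l / 2 * ‖y₁ - y'‖ ^ 2) ≤ t * C := by
      rw [hCdef]
      nlinarith [mul_le_mul_of_nonneg_left h3 (by linarith : (0 : ℝ) ≤ 1 - t),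
        mul_le_mul_of_nonneg_left h4 ht0.le]
    nlinarith [mul_nonneg hl.le hn]
  have h8 : t * (8 * (C + 1)) ≤ δ ^ 2 * l := by
    rw [← le_div_iff₀ (by positivity)]; exact min_le_right _ _
  have h9 : ‖y₁ - y'‖ ^ 2 < δ ^ 2 := by
    have : l * ‖y₁ - y'‖ ^ 2 < l * δ ^ 2 := by nlinarith
    exact lt_of_mul_lt_mul_left this hl.le
  have h10 : ‖y₁ - y'‖ < δ := lt_of_pow_lt_pow_left₀ 2 hδ.le h9
  have h11 : h x y₁ < h x' y' := hball ⟨by simpa [dist_eq_norm] using h10, hy₁⟩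
  linarith

theorem existsUnique_isSaddle [ProperSpace E] [ProperSpace F]
    (H : StrongConvexConcave X Y m l h) : ∃! p, IsSaddle X Y h p := by
  obtain ⟨p, hp⟩ := H.exists_isSaddle
  refine ⟨p, hp, fun q hq => ?_⟩
  have h1 : q.1 = p.1 := H.strongConvexOn_primalObj.eq_of_isMinOn H.pos_left hq.1
    (H.isMinOn_primalObj_of_isSaddle hq) hp.1 (H.isMinOn_primalObj_of_isSaddle hp)
  have h2 : q.2 = p.2 := by
    refine ((H.concave p.1 hp.1).strictConcaveOn H.pos_right).eq_of_isMaxOn ?_ ?_ hq.2.1 hp.2.1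
    · intro y hy
      have := hq.2.2 q.1 hq.1 y hy
      rwa [h1] at this
    · exact fun y hy => hp.2.2 p.1 hp.1 y hy
  exact Prod.ext h1 h2

lemma isSaddle_saddlePoint [ProperSpace E] [ProperSpace F] (H : StrongConvexConcave X Y m l h) :
    IsSaddle X Y h (saddlePoint X Y h) :=
  Classical.epsilon_spec H.exists_isSaddle

end StrongConvexConcave

end StrongConvexity

/-! ### Subgradients of weakly convex functions -/

section Subdifferential

variable {E : Type*} [NormedAddCommGroup E] [InnerProductSpace ℝ E]

/-- Weak convexity is strong convexity of negative modulus, so one segment inequality serves for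
both. -/
lemma WeaklyConvexOn.strongConvexOn {s : Set E} {ρ : ℝ} {g : E → ℝ} (hg : WeaklyConvexOn s ρ g) :
    StrongConvexOn s (-ρ) g := by
  rw [strongConvexOn_iff_convex]
  refine hg.congr fun x _ => ?_
  ring

/-- A Fréchet subgradient carries only local information. Testing it at `(1 - t) x + t z`, comparing
with weak convexity along the segment and dividing by `t` makes it global. -/
lemma WeaklyConvexOn.le_of_mem_frechetSubdiff {s : Set E} {ρ : ℝ} {g : E → ℝ} (hρ : 0 ≤ ρ)
    (hg : WeaklyConvexOn s ρ g) {x v : E} (hv : v ∈ frechetSubdiff s g x) {z : E} (hz : z ∈ s) :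
    g x + inner ℝ v (z - x) - ρ / 2 * ‖z - x‖ ^ 2 ≤ g z := by
  obtain ⟨hx, hv⟩ := hv
  suffices h : ∀ c > 0, -(c * ‖z - x‖) ≤
      g z - g x - inner ℝ v (z - x) + ρ / 2 * ‖z - x‖ ^ 2 by
    by_contra! hlt
    have hN : 0 ≤ ‖z - x‖ := norm_nonneg _
    set D := g x + inner ℝ v (z - x) - ρ / 2 * ‖z - x‖ ^ 2 - g z with hD
    have hD0 : 0 < D := by linarith
    have h1 := h (D / (2 * (‖z - x‖ + 1))) (by positivity)
    have h2 : D / (2 * (‖z - x‖ + 1)) * ‖z - x‖ ≤ D / 2 := by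
      rw [div_mul_eq_mul_div, div_le_div_iff₀ (by positivity) (by norm_num)]
      nlinarith
    linarith
  intro c hc
  have htend : Tendsto (fun t : ℝ => (1 - t) • x + t • z) (𝓝[>] 0) (𝓝[s] x) := by
    refine tendsto_nhdsWithin_iff.2 ⟨?_, ?_⟩
    · have : Continuous fun t : ℝ => (1 - t) • x + t • z := by fun_prop
      simpa using (this.tendsto 0).mono_left nhdsWithin_le_nhds
    · filter_upwards [Ioo_mem_nhdsGT (zero_lt_one (α := ℝ))] with t ht
      exact hg.1 hx hz (by linarith [ht.2]) ht.1.le (by ring)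
  obtain ⟨t, ht1, ht0⟩ := ((htend.eventually (hv c hc)).and
    (Ioo_mem_nhdsGT (zero_lt_one (α := ℝ)))).exists
  have h2 := hg.strongConvexOn.2 hx hz (by linarith [ht0.2] : (0 : ℝ) ≤ 1 - t) ht0.1.le (by ring)
  have h3 : (1 - t) • x + t • z - x = t • (z - x) := by module
  rw [h3, norm_smul, inner_smul_right, Real.norm_of_nonneg ht0.1.le] at ht1
  simp only [smul_eq_mul] at h2
  rw [norm_sub_rev x z] at h2
  refine le_of_mul_le_mul_left ?_ ht0.1
  have h4 : 0 ≤ t * t * (ρ / 2 * ‖z - x‖ ^ 2) :=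
    mul_nonneg (mul_self_nonneg t) (by positivity)
  nlinarith

/-- Limiting subgradients of a weakly convex function satisfy the subgradient inequality up to a
quadratic error. -/
lemma WeaklyConvexOn.le_of_mem_limitingSubdiff {s : Set E} {ρ : ℝ} {g : E → ℝ} (hρ : 0 ≤ ρ)
    (hg : WeaklyConvexOn s ρ g) {x v : E} (hv : v ∈ limitingSubdiff s g x) {z : E} (hz : z ∈ s) :
    g x + inner ℝ v (z - x) - ρ / 2 * ‖z - x‖ ^ 2 ≤ g z := by
  obtain ⟨-, u, w, hw, hu, hgu, hwv⟩ := hv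
  have h1 : Tendsto (fun n => g (u n) + inner ℝ (w n) (z - u n) - ρ / 2 * ‖z - u n‖ ^ 2) atTop
      (𝓝 (g x + inner ℝ v (z - x) - ρ / 2 * ‖z - x‖ ^ 2)) :=
    (hgu.add (hwv.inner (hu.const_sub z))).sub (((hu.const_sub z).norm.pow 2).const_mul _)
  exact le_of_tendsto' h1 fun n => hg.le_of_mem_frechetSubdiff hρ (hw n) hz

lemma frechetSubdiff_subset_limitingSubdiff (s : Set E) (g : E → ℝ) (x : E) :
    frechetSubdiff s g x ⊆ limitingSubdiff s g x := fun v hv =>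
  ⟨hv.1, fun _ => x, fun _ => v, fun _ => hv, tendsto_const_nhds, tendsto_const_nhds,
    tendsto_const_nhds⟩

/-- The optimality condition of a proximal point, without convexity. -/
lemma smul_sub_mem_frechetSubdiff_of_isMinOn {s : Set E} {g : E → ℝ} {γ : ℝ} (hγ : 0 ≤ γ) {c x : E}
    (hx : x ∈ s) (hmin : IsMinOn (fun z => g z + γ / 2 * ‖z - c‖ ^ 2) s x) :
    γ • (c - x) ∈ frechetSubdiff s g x := by
  refine ⟨hx, fun e he => ?_⟩
  have hnhds : ∀ᶠ z in 𝓝[s] x, z ∈ Metric.ball x (2 * e / (γ + 1)) :=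
    mem_nhdsWithin_of_mem_nhds (Metric.ball_mem_nhds x (by positivity))
  filter_upwards [hnhds, self_mem_nhdsWithin] with z hz hzs
  have h1 : g x + γ / 2 * ‖x - c‖ ^ 2 ≤ g z + γ / 2 * ‖z - c‖ ^ 2 := hmin hzs
  have h2 : ‖z - c‖ ^ 2 = ‖z - x‖ ^ 2 - 2 * inner ℝ (c - x) (z - x) + ‖x - c‖ ^ 2 := by
    rw [show z - c = (z - x) - (c - x) by abel, norm_sub_sq_real, real_inner_comm,
      norm_sub_rev x c]
  rw [Metric.mem_ball, dist_eq_norm, lt_div_iff₀ (by positivity)] at hz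
  rw [inner_smul_left]
  simp only [conj_trivial]
  have hN : 0 ≤ ‖z - x‖ := norm_nonneg _
  have h3 : γ / 2 * ‖z - x‖ ^ 2 ≤ e * ‖z - x‖ := by nlinarith
  rw [h2] at h1
  linarith

end Subdifferential

/-! ### The regularized problem and the proximal point of `P` -/

section Regularization

variable {E F : Type*} [NormedAddCommGroup E] [InnerProductSpace ℝ E]
  [NormedAddCommGroup F] [InnerProductSpace ℝ F]

/-- A jointly continuous function on a product of closed convex sets that is weakly convex in the
first and strongly concave in the second variable. -/
structure WeaklyConvexStronglyConcave (X : Set E) (Y : Set F) (ρ lam : ℝ) (f : E → F → ℝ) :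
    Prop where
  closed_left : IsClosed X
  closed_right : IsClosed Y
  nonempty_left : X.Nonempty
  nonempty_right : Y.Nonempty
  pos_left : 0 < ρ
  pos_right : 0 < lam
  weaklyConvex : ∀ y ∈ Y, WeaklyConvexOn X ρ fun x => f x y
  concave : ∀ x ∈ X, StrongConcaveOn Y lam (f x)
  cont : ContinuousOn (fun p : E × F => f p.1 p.2) (X ×ˢ Y)

namespace WeaklyConvexStronglyConcave

variable {X : Set E} {Y : Set F} {ρ lam : ℝ} {f : E → F → ℝ}

lemma convex_left (W : WeaklyConvexStronglyConcave X Y ρ lam f) : Convex ℝ X :=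
  (W.weaklyConvex _ W.nonempty_right.some_mem).1

lemma convex_right (W : WeaklyConvexStronglyConcave X Y ρ lam f) : Convex ℝ Y :=
  (W.concave _ W.nonempty_left.some_mem).1

/-- The prox term has modulus `2ρ`, of which weak convexity consumes `ρ`. -/
lemma strongConvexConcave_regObj (W : WeaklyConvexStronglyConcave X Y ρ lam f) (c : E) :
    StrongConvexConcave X Y ρ lam (regObj (2 * ρ) c f) where
  closed_left := W.closed_left
  closed_right := W.closed_right
  nonempty_left := W.nonempty_left
  nonempty_right := W.nonempty_right
  pos_left := W.pos_left
  pos_right := W.pos_right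
  convex y hy := by
    refine ⟨W.convex_left, fun x hx z hz a b ha hb hab => ?_⟩
    have h := (W.weaklyConvex y hy).strongConvexOn.2 hx hz ha hb hab
    have h2 : ‖a • x + b • z - c‖ ^ 2
        = a * ‖x - c‖ ^ 2 + b * ‖z - c‖ ^ 2 - a * b * ‖x - z‖ ^ 2 := by
      have h3 : a • x + b • z - c = a • (x - c) + b • (z - c) := by
        have : c = (a + b) • c := by rw [hab, one_smul]
        nth_rewrite 1 [this]; module
      rw [h3, show x - z = (x - c) - (z - c) by abel, norm_add_sq_real,
        norm_sub_sq_real (x - c), norm_smul, norm_smul, real_inner_smul_left, inner_smul_right,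
        Real.norm_of_nonneg ha, Real.norm_of_nonneg hb]
      obtain rfl := eq_sub_of_add_eq hab
      ring
    simp only [smul_eq_mul, regObj] at h ⊢
    rw [h2]
    linarith
  concave x hx := by
    refine ⟨W.convex_right, fun y hy z hz a b ha hb hab => ?_⟩
    have h := (W.concave x hx).2 hy hz ha hb hab
    simp only [smul_eq_mul, regObj] at h ⊢
    have : (a + b) * (2 * ρ / 2 * ‖x - c‖ ^ 2) = 2 * ρ / 2 * ‖x - c‖ ^ 2 := by rw [hab, one_mul]
    linarith
  cont_left y hy := by
    have : ContinuousOn (fun x => f x y) X :=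
      W.cont.comp (f := fun x => (x, y)) (by fun_prop) fun x hx => ⟨hx, hy⟩
    unfold regObj
    fun_prop
  cont_right x hx := by
    have : ContinuousOn (fun y => f x y) Y :=
      W.cont.comp (f := fun y => (x, y)) (by fun_prop) fun y hy => ⟨hx, hy⟩
    unfold regObj
    fun_prop

variable [ProperSpace F]

lemma primalObj_regObj (W : WeaklyConvexStronglyConcave X Y ρ lam f) (c : E) {x : E}
    (hx : x ∈ X) : primalObj Y (regObj (2 * ρ) c f) x = primalObj Y f x + ρ * ‖x - c‖ ^ 2 := by
  obtain ⟨y, hy, hmax⟩ := (W.strongConvexConcave_regObj c).exists_isMaxOn hx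
  rw [primalObj_eq_of_isMaxOn hy hmax, primalObj_eq_of_isMaxOn (h := f) hy fun z hz => ?_]
  · simp only [regObj]; ring
  · have : f x z + _ ≤ f x y + _ := hmax hz
    exact le_of_add_le_add_right this

lemma le_primalObj (W : WeaklyConvexStronglyConcave X Y ρ lam f) {x : E} (hx : x ∈ X) {y : F}
    (hy : y ∈ Y) : f x y ≤ primalObj Y f x := by
  have h := (W.strongConvexConcave_regObj x).le_primalObj hx hy
  rw [W.primalObj_regObj x hx] at h
  simpa [regObj] using h

variable [ProperSpace E]

/-- The primal part of the saddle point of the regularized problem is the proximal point of the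
primal objective. -/
lemma isMinOn_saddlePoint_fst (W : WeaklyConvexStronglyConcave X Y ρ lam f) (c : E) :
    IsMinOn (fun z => primalObj Y f z + 2 * ρ / 2 * ‖z - c‖ ^ 2) X
      (saddlePoint X Y (regObj (2 * ρ) c f)).1 := by
  have H := W.strongConvexConcave_regObj c
  have hp := H.isSaddle_saddlePoint
  intro z hz
  have h := H.isMinOn_primalObj_of_isSaddle hp hz
  simp only [Set.mem_ofPred_eq] at h ⊢
  rw [W.primalObj_regObj c hz, W.primalObj_regObj c hp.1] at h
  linarith

lemma smul_sub_mem_limitingSubdiff (W : WeaklyConvexStronglyConcave X Y ρ lam f) (c : E) :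
    (2 * ρ) • (c - (saddlePoint X Y (regObj (2 * ρ) c f)).1) ∈
      limitingSubdiff X (primalObj Y f) (saddlePoint X Y (regObj (2 * ρ) c f)).1 :=
  frechetSubdiff_subset_limitingSubdiff _ _ _ <|
    smul_sub_mem_frechetSubdiff_of_isMinOn (by have := W.pos_left; positivity)
      (W.strongConvexConcave_regObj c).isSaddle_saddlePoint.1 (W.isMinOn_saddlePoint_fst c)

lemma infEDist_limitingSubdiff_le (W : WeaklyConvexStronglyConcave X Y ρ lam f) (c : E) :
    Metric.infEDist 0
        (limitingSubdiff X (primalObj Y f) (saddlePoint X Y (regObj (2 * ρ) c f)).1) ≤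
      ENNReal.ofReal (2 * ρ) * ‖(saddlePoint X Y (regObj (2 * ρ) c f)).1 - c‖ₑ := by
  refine (Metric.infEDist_le_edist_of_mem (W.smul_sub_mem_limitingSubdiff c)).trans ?_
  rw [edist_zero_left, ← enorm_eq_nnnorm, enorm_smul, ← enorm_neg (c - _), neg_sub,
    Real.enorm_of_nonneg (by have := W.pos_left; positivity)]

/-- Adding the quadratic growth inequalities of the two regularized primal objectives at each
other's minimizers cancels `P`. The Lipschitz bound is there to make the proximal points measurable
in the center. -/
lemma dist_saddlePoint_fst_le (W : WeaklyConvexStronglyConcave X Y ρ lam f) (c c' : E) :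
    dist (saddlePoint X Y (regObj (2 * ρ) c f)).1 (saddlePoint X Y (regObj (2 * ρ) c' f)).1 ≤
      2 * dist c c' := by
  have H := W.strongConvexConcave_regObj c
  have H' := W.strongConvexConcave_regObj c'
  have hp := H.isSaddle_saddlePoint
  have hp' := H'.isSaddle_saddlePoint
  have h1 := H.strongConvexOn_primalObj.add_le_of_isMinOn hp.1
    (H.isMinOn_primalObj_of_isSaddle hp) hp'.1
  have h2 := H'.strongConvexOn_primalObj.add_le_of_isMinOn hp'.1
    (H'.isMinOn_primalObj_of_isSaddle hp') hp.1
  set x := (saddlePoint X Y (regObj (2 * ρ) c f)).1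
  set x' := (saddlePoint X Y (regObj (2 * ρ) c' f)).1
  rw [W.primalObj_regObj c hp.1, W.primalObj_regObj c hp'.1] at h1
  rw [W.primalObj_regObj c' hp.1, W.primalObj_regObj c' hp'.1] at h2
  rw [norm_sub_rev x' x] at h1
  have hρ := W.pos_left
  have h3 : ρ * ‖x - x'‖ ^ 2 ≤ ρ * (2 * inner ℝ (x - x') (c - c')) := by
    have h4 : 2 * inner ℝ (x - x') (c - c')
        = ‖x' - c‖ ^ 2 - ‖x - c‖ ^ 2 + ‖x - c'‖ ^ 2 - ‖x' - c'‖ ^ 2 := by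
      simp only [norm_sub_sq_real, inner_sub_left, inner_sub_right]
      ring
    rw [h4]; linarith
  have h5 := le_of_mul_le_mul_left h3 hρ
  have h6 := real_inner_le_norm (x - x') (c - c')
  rw [dist_eq_norm, dist_eq_norm]
  by_contra! hlt
  nlinarith [norm_nonneg (c - c'), norm_nonneg (x - x')]

lemma continuous_saddlePoint_fst (W : WeaklyConvexStronglyConcave X Y ρ lam f) :
    Continuous fun c => (saddlePoint X Y (regObj (2 * ρ) c f)).1 :=
  (LipschitzWith.of_dist_le_mul (K := 2) fun c c' => W.dist_saddlePoint_fst_le c c').continuous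

end WeaklyConvexStronglyConcave

end Regularization

/-! ### Proximal steps and their regret -/

section ProximalStep

variable {E : Type*} [NormedAddCommGroup E] [InnerProductSpace ℝ E]

/-- The proximal step from `p` along `-g` with step size `η`, regularized around `c`. -/
def proxStep (X : Set E) (γ η : ℝ) (c p g : E) : E :=
  argMinOver X fun x => inner ℝ x g + 1 / (2 * η) * ‖x - p‖ ^ 2 + γ / 2 * ‖x - c‖ ^ 2

lemma strongConvexOn_proxStep_objective {X : Set E} (hX : Convex ℝ X) (γ η : ℝ) (c p g : E) :
    StrongConvexOn X (1 / η + γ)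
      fun x => inner ℝ x g + 1 / (2 * η) * ‖x - p‖ ^ 2 + γ / 2 * ‖x - c‖ ^ 2 := by
  rw [strongConvexOn_iff_convex]
  have h : ∀ x : E, inner ℝ x g + 1 / (2 * η) * ‖x - p‖ ^ 2 + γ / 2 * ‖x - c‖ ^ 2
      - (1 / η + γ) / 2 * ‖x‖ ^ 2
      = innerₗ E (g - (1 / η) • p - γ • c) x + (1 / (2 * η) * ‖p‖ ^ 2 + γ / 2 * ‖c‖ ^ 2) := by
    intro x
    rw [innerₗ_apply_apply, real_inner_comm x (g - (1 / η) • p - γ • c)]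
    simp only [norm_sub_sq_real, inner_sub_right, inner_smul_right]
    ring
  simp only [h]
  exact ((innerₗ E (g - (1 / η) • p - γ • c)).convexOn hX).add_const _

section

variable [ProperSpace E] {X : Set E} {γ η : ℝ}

/-- The three-point inequality: quadratic growth of the step's objective, whose modulus is `1 / η +
γ`. -/
lemma proxStep_spec (hX : Convex ℝ X) (hXc : IsClosed X) (hne : X.Nonempty) (hη : 0 < η)
    (hγ : 0 ≤ γ) (c p g : E) :
    proxStep X γ η c p g ∈ X ∧ ∀ z ∈ X,
      inner ℝ (proxStep X γ η c p g) g + 1 / (2 * η) * ‖proxStep X γ η c p g - p‖ ^ 2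
          + γ / 2 * ‖proxStep X γ η c p g - c‖ ^ 2
          + (1 / η + γ) / 2 * ‖z - proxStep X γ η c p g‖ ^ 2 ≤
        inner ℝ z g + 1 / (2 * η) * ‖z - p‖ ^ 2 + γ / 2 * ‖z - c‖ ^ 2 := by
  have hsc := strongConvexOn_proxStep_objective hX γ η c p g
  have hex := hsc.exists_isMinOn (by positivity) hXc hne
    (Continuous.continuousOn (by fun_prop)).lowerSemicontinuousOn
  have hspec := Classical.epsilon_spec hex
  exact ⟨hspec.1, fun z hz => hsc.add_le_of_isMinOn hspec.1 hspec.2 hz⟩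

lemma norm_proxStep_sub_le (hX : Convex ℝ X) (hXc : IsClosed X) (hne : X.Nonempty) (hη : 0 < η)
    (hγ : 0 ≤ γ) (c p g c' p' g' : E) :
    ‖proxStep X γ η c p g - proxStep X γ η c' p' g'‖ ≤
      ‖p - p'‖ + η * γ * ‖c - c'‖ + η * ‖g - g'‖ := by
  obtain ⟨hx, h1⟩ := proxStep_spec hX hXc hne hη hγ c p g
  obtain ⟨hx', h2⟩ := proxStep_spec hX hXc hne hη hγ c' p' g'
  replace h1 := h1 _ hx'
  replace h2 := h2 _ hx
  set x := proxStep X γ η c p g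
  set x' := proxStep X γ η c' p' g'
  rw [norm_sub_rev x' x] at h1
  have h3 : (1 / η + γ) * ‖x - x'‖ ^ 2 ≤
      inner ℝ (x - x') (g' - g) + 1 / η * inner ℝ (x - x') (p - p')
        + γ * inner ℝ (x - x') (c - c') := by
    simp only [inner_sub_left, inner_sub_right]
    have e1 : 1 / (2 * η) = 1 / η / 2 := by field_simp
    rw [e1] at h1 h2
    simp only [norm_sub_sq_real x p, norm_sub_sq_real x c, norm_sub_sq_real x' p,
      norm_sub_sq_real x' c, norm_sub_sq_real x p', norm_sub_sq_real x c', norm_sub_sq_real x' p',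
      norm_sub_sq_real x' c'] at h1 h2
    linarith
  have i1 := real_inner_le_norm (x - x') (g' - g)
  have i2 := real_inner_le_norm (x - x') (p - p')
  have i3 := real_inner_le_norm (x - x') (c - c')
  rw [norm_sub_rev g' g] at i1
  set N := ‖x - x'‖ with hN
  have hN0 : 0 ≤ N := norm_nonneg _
  have h4 : (1 + η * γ) * N ^ 2 ≤ N * (‖p - p'‖ + η * γ * ‖c - c'‖ + η * ‖g - g'‖) := by
    have h5 : η * ((1 / η + γ) * N ^ 2) ≤ η * (N * ‖g - g'‖ + 1 / η * (N * ‖p - p'‖)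
        + γ * (N * ‖c - c'‖)) := by
      refine mul_le_mul_of_nonneg_left (h3.trans ?_) hη.le
      gcongr
    have h6 : η * ((1 / η + γ) * N ^ 2) = (1 + η * γ) * N ^ 2 := by field_simp
    have h7 : η * (N * ‖g - g'‖ + 1 / η * (N * ‖p - p'‖) + γ * (N * ‖c - c'‖))
        = N * (‖p - p'‖ + η * γ * ‖c - c'‖ + η * ‖g - g'‖) := by field_simp; ring
    rwa [h6, h7] at h5
  rcases hN0.eq_or_lt with h | h
  · rw [← h]; positivity
  · refine le_of_mul_le_mul_left ?_ h
    nlinarith [mul_nonneg (mul_nonneg hη.le hγ) (sq_nonneg N)]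

lemma continuous_proxStep (hX : Convex ℝ X) (hXc : IsClosed X) (hne : X.Nonempty) (hη : 0 < η)
    (hγ : 0 ≤ γ) : Continuous fun q : E × E × E => proxStep X γ η q.1 q.2.1 q.2.2 := by
  refine continuous_iff_continuousAt.2 fun q => ?_
  refine tendsto_iff_norm_sub_tendsto_zero.2 ?_
  have hc : Continuous fun r : E × E × E =>
      ‖r.2.1 - q.2.1‖ + η * γ * ‖r.1 - q.1‖ + η * ‖r.2.2 - q.2.2‖ := by fun_prop
  refine squeeze_zero (fun _ => norm_nonneg _)
    (fun r => norm_proxStep_sub_le hX hXc hne hη hγ r.1 r.2.1 r.2.2 q.1 q.2.1 q.2.2) ?_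
  simpa using hc.tendsto q

lemma proxStep_self (hX : Convex ℝ X) (hXc : IsClosed X) (hη : 0 < η)
    (hγ : 0 ≤ γ) {c : E} (hc : c ∈ X) : proxStep X γ η c c 0 = c := by
  obtain ⟨-, h⟩ := proxStep_spec hX hXc ⟨c, hc⟩ hη hγ c c 0
  have h1 := h c hc
  rw [norm_sub_rev c] at h1
  simp only [inner_zero_right, sub_self, norm_zero] at h1
  have h2 : 0 < 1 / η + γ := by positivity
  have h3 : ‖proxStep X γ η c c 0 - c‖ ^ 2 ≤ 0 := by
    by_contra! h4
    have h5 : 0 < 1 / (2 * η) * ‖proxStep X γ η c c 0 - c‖ ^ 2 := by positivity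
    nlinarith [mul_nonneg hγ h4.le, mul_pos h2 h4]
  have h4 : ‖proxStep X γ η c c 0 - c‖ = 0 := by
    have := sq_nonneg ‖proxStep X γ η c c 0 - c‖
    exact pow_eq_zero_iff two_ne_zero |>.1 (le_antisymm h3 this)
  exact sub_eq_zero.1 (norm_eq_zero.1 h4)

/-- Compares the step with the one from `c` along the zero gradient, which does not move. It yields
square integrability of the iterates on unbounded sets. -/
lemma norm_proxStep_sub_center_le (hX : Convex ℝ X) (hXc : IsClosed X) (hη : 0 < η)
    (hγ : 0 ≤ γ) {c : E} (hc : c ∈ X) (p g : E) :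
    ‖proxStep X γ η c p g - c‖ ≤ ‖p - c‖ + η * ‖g‖ := by
  have h := norm_proxStep_sub_le hX hXc ⟨c, hc⟩ hη hγ c p g c c 0
  rw [proxStep_self hX hXc hη hγ hc] at h
  simpa using h

end

/-- The stochastic error terms in the regret bound for proximal steps with stochastic gradients
`g t` of mean `gb t` taken at the points `x t`. -/
def proxNoise (η : ℝ) (g gb x : ℕ → E) (T : ℕ) : ℝ :=
  η / 2 * ∑ t ∈ Finset.range T, ‖g t‖ ^ 2
    + ∑ t ∈ Finset.range T, inner ℝ (gb t - g t) (x t - x 0)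
    + η / 2 * ‖∑ t ∈ Finset.range T, (gb t - g t)‖ ^ 2

/-- The regret bound for proximal steps with stochastic gradients. -/
lemma sum_inner_le_of_proxStep [ProperSpace E] {X : Set E} {ρ γ η : ℝ} (hX : Convex ℝ X)
    (hXc : IsClosed X) (hη : 0 < η) (hρ : 0 ≤ ρ) (hργ : ρ ≤ γ) {g gb x : ℕ → E}
    (hstep : ∀ t, x (t + 1) = proxStep X γ η (x 0) (x t) (g t)) {z : E} (hz : z ∈ X) (T : ℕ) :
    ∑ t ∈ Finset.range T, (inner ℝ (gb t) (x t - z) + ρ / 2 * ‖z - x t‖ ^ 2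
        + γ / 2 * ‖x t - x 0‖ ^ 2 - γ / 2 * ‖z - x 0‖ ^ 2) ≤
      (1 / η + γ / 2) * ‖z - x 0‖ ^ 2 + proxNoise η g gb x T := by
  have hγ : 0 ≤ γ := hρ.trans hργ
  have e1 : 1 / (2 * η) = 1 / η / 2 := by field_simp
  -- The surplus modulus `γ` of each step absorbs the weak convexity error, as `ρ ≤ γ`. Each step
  -- controls the prox term at `t + 1`, not at `t`; the shift costs nothing because that term
  -- vanishes at `t = 0`, and the last one is kept on the left.
  have key : ∀ T, ∑ t ∈ Finset.range T, (inner ℝ (g t) (x t - z) + ρ / 2 * ‖z - x t‖ ^ 2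
        + γ / 2 * ‖x t - x 0‖ ^ 2 - γ / 2 * ‖z - x 0‖ ^ 2) + γ / 2 * ‖x T - x 0‖ ^ 2
        + (1 / η / 2 + γ / 2) * ‖z - x T‖ ^ 2 ≤
      (1 / η / 2 + γ / 2) * ‖z - x 0‖ ^ 2 + η / 2 * ∑ t ∈ Finset.range T, ‖g t‖ ^ 2 := by
    intro T
    induction T with
    | zero => simp
    | succ T ih =>
      rw [Finset.sum_range_succ, Finset.sum_range_succ]
      have h1 := (proxStep_spec hX hXc ⟨z, hz⟩ hη hγ (x 0) (x T) (g T)).2 z hz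
      rw [← hstep T, e1] at h1
      have h2 : inner ℝ (g T) (x T - x (T + 1)) ≤
          η / 2 * ‖g T‖ ^ 2 + 1 / η / 2 * ‖x (T + 1) - x T‖ ^ 2 := by
        have h3 := real_inner_le_norm (g T) (x T - x (T + 1))
        rw [norm_sub_rev (x T)] at h3
        refine h3.trans ?_
        have h4 : 0 ≤ (η * ‖g T‖ - ‖x (T + 1) - x T‖) ^ 2 / (2 * η) := by positivity
        have h5 : (η * ‖g T‖ - ‖x (T + 1) - x T‖) ^ 2 / (2 * η) = η / 2 * ‖g T‖ ^ 2
            + 1 / η / 2 * ‖x (T + 1) - x T‖ ^ 2 - ‖g T‖ * ‖x (T + 1) - x T‖ := by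
          field_simp; ring
        linarith
      have h6 : (ρ / 2) * ‖z - x T‖ ^ 2 ≤ γ / 2 * ‖z - x T‖ ^ 2 := by gcongr
      rw [real_inner_comm (g T) (x (T + 1)), real_inner_comm (g T) z] at h1
      rw [inner_sub_right] at h2
      rw [inner_sub_right (g T)]
      linarith
  have h1 := key T
  -- The comparator `z` may depend on the noise, so this term need not have mean zero. Young's
  -- inequality separates the two, at the price of a second `1 / (2η)` in front of `‖z - x 0‖ ^ 2`.
  have h2 : inner ℝ (∑ t ∈ Finset.range T, (gb t - g t)) (x 0 - z) ≤
      1 / η / 2 * ‖z - x 0‖ ^ 2 + η / 2 * ‖∑ t ∈ Finset.range T, (gb t - g t)‖ ^ 2 := by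
    set D := ∑ t ∈ Finset.range T, (gb t - g t)
    have h3 := real_inner_le_norm D (x 0 - z)
    rw [norm_sub_rev (x 0)] at h3
    refine h3.trans ?_
    have h4 : 0 ≤ (η * ‖D‖ - ‖z - x 0‖) ^ 2 / (2 * η) := by positivity
    have h5 : (η * ‖D‖ - ‖z - x 0‖) ^ 2 / (2 * η) = η / 2 * ‖D‖ ^ 2
        + 1 / η / 2 * ‖z - x 0‖ ^ 2 - ‖D‖ * ‖z - x 0‖ := by
      field_simp; ring
    linarith
  have h3 : ∑ t ∈ Finset.range T, (inner ℝ (gb t) (x t - z) + ρ / 2 * ‖z - x t‖ ^ 2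
        + γ / 2 * ‖x t - x 0‖ ^ 2 - γ / 2 * ‖z - x 0‖ ^ 2)
      = ∑ t ∈ Finset.range T, (inner ℝ (g t) (x t - z) + ρ / 2 * ‖z - x t‖ ^ 2
        + γ / 2 * ‖x t - x 0‖ ^ 2 - γ / 2 * ‖z - x 0‖ ^ 2)
      + ∑ t ∈ Finset.range T, inner ℝ (gb t - g t) (x t - x 0)
      + inner ℝ (∑ t ∈ Finset.range T, (gb t - g t)) (x 0 - z) := by
    rw [sum_inner, ← Finset.sum_add_distrib, ← Finset.sum_add_distrib]
    refine Finset.sum_congr rfl fun t _ => ?_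
    simp only [inner_sub_left, inner_sub_right]
    ring
  have h4 : 0 ≤ γ / 2 * ‖x T - x 0‖ ^ 2 := by positivity
  have h5 : 0 ≤ (1 / η / 2 + γ / 2) * ‖z - x T‖ ^ 2 := by positivity
  rw [h3, proxNoise]
  linarith

end ProximalStep

/-- The dual objective `min_{x ∈ X} h(x, y)`. -/
def dualObj {E F : Type*} (X : Set E) (h : E → F → ℝ) (y : F) : ℝ :=
  sInf ((fun x => h x y) '' X)

/-- The duality gap of `h` at `(x, y)` as a real number. -/
def saddleGap {E F : Type*} (X : Set E) (Y : Set F) (h : E → F → ℝ) (x : E) (y : F) : ℝ :=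
  primalObj Y h x - dualObj X h y

lemma dualObj_eq_of_isMinOn {E F : Type*} {X : Set E} {h : E → F → ℝ} {x : E} {y : F} (hx : x ∈ X)
    (hmin : IsMinOn (fun x => h x y) X x) : dualObj X h y = h x y :=
  IsLeast.csInf_eq ⟨⟨x, hx, rfl⟩, by rintro _ ⟨z, hz, rfl⟩; exact hmin hz⟩

/-! ### Duality gaps: one epoch, recentering, telescoping -/

section Gap

variable {E F : Type*} [NormedAddCommGroup E] [InnerProductSpace ℝ E]
  [NormedAddCommGroup F] [InnerProductSpace ℝ F] [ProperSpace E] [ProperSpace F]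

namespace StrongConvexConcave

variable {X : Set E} {Y : Set F} {m l : ℝ} {h : E → F → ℝ}

omit [ProperSpace F] in
lemma dualObj_le (H : StrongConvexConcave X Y m l h) {x : E} (hx : x ∈ X) {y : F} (hy : y ∈ Y) :
    dualObj X h y ≤ h x y := by
  obtain ⟨z, hz, hmin⟩ := H.exists_isMinOn hy
  rw [dualObj_eq_of_isMinOn hz hmin]
  exact hmin hx

lemma saddleGap_nonneg (H : StrongConvexConcave X Y m l h) {x : E} (hx : x ∈ X) {y : F}
    (hy : y ∈ Y) : 0 ≤ saddleGap X Y h x y :=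
  sub_nonneg.2 ((H.dualObj_le hx hy).trans (H.le_primalObj hx hy))

/-- Best responses to `(x₁, y₁)` are close to `(x₀, y₀)` if both points have a small gap. -/
lemma exists_bestResponse (H : StrongConvexConcave X Y m l h) {x₀ x₁ : E} (hx₀ : x₀ ∈ X)
    (hx₁ : x₁ ∈ X) {y₀ y₁ : F} (hy₀ : y₀ ∈ Y) (hy₁ : y₁ ∈ Y) :
    ∃ x ∈ X, ∃ y ∈ Y, saddleGap X Y h x₁ y₁ = h x₁ y - h x y₁ ∧
      m * ‖x - x₀‖ ^ 2 + l * ‖y - y₀‖ ^ 2 ≤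
        4 * (saddleGap X Y h x₀ y₀ + saddleGap X Y h x₁ y₁) := by
  obtain ⟨x, hx, hmin⟩ := H.exists_isMinOn hy₁
  obtain ⟨y, hy, hmax⟩ := H.exists_isMaxOn hx₁
  obtain ⟨p, hpX, hpY, hp⟩ := H.exists_isSaddle
  have hgap : saddleGap X Y h x₁ y₁ = h x₁ y - h x y₁ := by
    rw [saddleGap, dualObj_eq_of_isMinOn hx hmin, primalObj_eq_of_isMaxOn hy hmax]
  refine ⟨x, hx, y, hy, hgap, ?_⟩
  have hpmin : IsMinOn (fun x => h x p.2) X p.1 := fun z hz => hp z hz p.2 hpY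
  have hpmax : IsMaxOn (h p.1) Y p.2 := fun z hz => hp p.1 hpX z hz
  have h1 := (H.convex p.2 hpY).add_le_of_isMinOn hpX hpmin hx₀
  have h2 := (H.convex y₁ hy₁).add_le_of_isMinOn hx hmin hpX
  have h3 := (H.concave p.1 hpX).le_of_isMaxOn hpY hpmax hy₀
  have h4 := (H.concave x₁ hx₁).le_of_isMaxOn hy hmax hpY
  have h5 : h p.1 y₁ ≤ h p.1 p.2 := hp _ hpX _ hy₁
  have h6 : h p.1 p.2 ≤ h x₁ p.2 := hp _ hx₁ _ hpY
  have h7 := H.le_primalObj hx₀ hpY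
  have h8 := H.dualObj_le hpX hy₀
  have h9 : ‖x - x₀‖ ^ 2 ≤ 2 * (‖p.1 - x‖ ^ 2 + ‖x₀ - p.1‖ ^ 2) := by
    have := norm_sub_le_norm_sub_add_norm_sub x p.1 x₀
    rw [norm_sub_rev x p.1, norm_sub_rev p.1 x₀] at this
    nlinarith [norm_nonneg (x - x₀), sq_nonneg (‖p.1 - x‖ - ‖x₀ - p.1‖)]
  have h10 : ‖y - y₀‖ ^ 2 ≤ 2 * (‖p.2 - y‖ ^ 2 + ‖y₀ - p.2‖ ^ 2) := by
    have := norm_sub_le_norm_sub_add_norm_sub y p.2 y₀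
    rw [norm_sub_rev y p.2, norm_sub_rev p.2 y₀] at this
    nlinarith [norm_nonneg (y - y₀), sq_nonneg (‖p.2 - y‖ - ‖y₀ - p.2‖)]
  have h11 := mul_le_mul_of_nonneg_left h9 H.pos_left.le
  have h12 := mul_le_mul_of_nonneg_left h10 H.pos_right.le
  have hg0 : saddleGap X Y h x₀ y₀ = primalObj Y h x₀ - dualObj X h y₀ := rfl
  rw [hgap, hg0]
  linarith

end StrongConvexConcave

namespace WeaklyConvexStronglyConcave

variable {X : Set E} {Y : Set F} {ρ lam : ℝ} {f : E → F → ℝ}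

/-- One epoch of proximal steps from `(x 0, y 0)` with stochastic gradients reduces the duality
gap of the regularized problem by a constant factor, up to noise. Here `gx`, `gy` are the
stochastic gradients of `f(·, y)` and `-f(x, ·)`, with means `gbx` and `gby`. -/
lemma saddleGap_average_le (W : WeaklyConvexStronglyConcave X Y ρ lam f) {x gx gbx : ℕ → E}
    {y gy gby : ℕ → F} {ηx ηy : ℝ} (hηx : 0 < ηx) (hηy : 0 < ηy) {T : ℕ} (hT : 0 < T)
    (hxX : ∀ t, x t ∈ X) (hyY : ∀ t, y t ∈ Y)
    (hx : ∀ t, x (t + 1) = proxStep X (2 * ρ) ηx (x 0) (x t) (gx t))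
    (hy : ∀ t, y (t + 1) = proxStep Y 0 ηy (y 0) (y t) (gy t))
    (hgbx : ∀ t, ∀ z ∈ X, f (x t) (y t) + inner ℝ (gbx t) (z - x t) - ρ / 2 * ‖z - x t‖ ^ 2 ≤
      f z (y t))
    (hgby : ∀ t, ∀ z ∈ Y, -f (x t) (y t) + inner ℝ (gby t) (z - y t) ≤ -f (x t) z)
    (hTx : 1 / ηx + ρ ≤ T * (9 / 424 * ρ)) (hTy : 1 / ηy ≤ T * (9 / 424 * lam)) :
    saddleGap X Y (regObj (2 * ρ) (x 0) f) ((T : ℝ)⁻¹ • ∑ t ∈ Finset.range T, x t)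
        ((T : ℝ)⁻¹ • ∑ t ∈ Finset.range T, y t) ≤
      1 / 10 * saddleGap X Y (regObj (2 * ρ) (x 0) f) (x 0) (y 0)
        + 106 / 97 * ((proxNoise ηx gx gbx x T + proxNoise ηy gy gby y T) / T) := by
  have hT0 : (0 : ℝ) < T := by exact_mod_cast hT
  have hw : ∑ _t ∈ Finset.range T, (T : ℝ)⁻¹ = 1 := by simp [hT0.ne']
  have hw0 : ∀ t ∈ Finset.range T, (0 : ℝ) ≤ (T : ℝ)⁻¹ := fun _ _ => by positivity
  rw [Finset.smul_sum, Finset.smul_sum]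
  set xb := ∑ t ∈ Finset.range T, (T : ℝ)⁻¹ • x t with hxb
  set yb := ∑ t ∈ Finset.range T, (T : ℝ)⁻¹ • y t with hyb
  have hxbX : xb ∈ X := W.convex_left.sum_mem hw0 hw fun t _ => hxX t
  have hybY : yb ∈ Y := W.convex_right.sum_mem hw0 hw fun t _ => hyY t
  have H := W.strongConvexConcave_regObj (x 0)
  have hρ := W.pos_left
  have hlam := W.pos_right
  obtain ⟨u, hu, v, hv, hgap, hclose⟩ := H.exists_bestResponse (hxX 0) hxbX (hyY 0) hybY
  have hG0 := H.saddleGap_nonneg (hxX 0) (hyY 0)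
  set h := regObj (2 * ρ) (x 0) f with hh
  -- Jensen's inequality passes from the averaged point to the iterates, with the best responses
  -- `u`, `v` to the average held fixed.
  have j1 : h xb v ≤ ∑ t ∈ Finset.range T, (T : ℝ)⁻¹ * h (x t) v := by
    have := ((H.convex v hv).convexOn fun r => by
      simp only [Pi.zero_apply]; positivity).map_sum_le hw0 hw fun t _ => hxX t
    simpa only [smul_eq_mul] using this
  have j2 : ∑ t ∈ Finset.range T, (T : ℝ)⁻¹ * h u (y t) ≤ h u yb := by
    have := ((H.concave u hu).concaveOn fun r => by
      simp only [Pi.zero_apply]; positivity).le_map_sum hw0 hw fun t _ => hyY t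
    simpa only [smul_eq_mul] using this
  rw [← Finset.mul_sum] at j1 j2
  have r1 := sum_inner_le_of_proxStep W.convex_left W.closed_left hηx hρ.le (by linarith : ρ ≤ 2 * ρ)
    (gb := gbx) hx hu T
  have r2 := sum_inner_le_of_proxStep W.convex_right W.closed_right hηy le_rfl le_rfl
    (gb := gby) hy hv T
  have s1 : ∑ t ∈ Finset.range T, h (x t) v - ∑ t ∈ Finset.range T, h u (y t) ≤
      ∑ t ∈ Finset.range T, (inner ℝ (gbx t) (x t - u) + ρ / 2 * ‖u - x t‖ ^ 2
        + 2 * ρ / 2 * ‖x t - x 0‖ ^ 2 - 2 * ρ / 2 * ‖u - x 0‖ ^ 2)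
      + ∑ t ∈ Finset.range T, (inner ℝ (gby t) (y t - v) + 0 / 2 * ‖v - y t‖ ^ 2
        + 0 / 2 * ‖y t - y 0‖ ^ 2 - 0 / 2 * ‖v - y 0‖ ^ 2) := by
    rw [← Finset.sum_sub_distrib, ← Finset.sum_add_distrib]
    refine Finset.sum_le_sum fun t _ => ?_
    have h1 := hgbx t u hu
    have h2 := hgby t v hv
    simp only [hh, regObj]
    simp only [inner_sub_right] at h1 h2 ⊢
    linarith
  have hG1 : (T : ℝ) * saddleGap X Y h xb yb ≤
      (1 / ηx + 2 * ρ / 2) * ‖u - x 0‖ ^ 2 + (1 / ηy + 0 / 2) * ‖v - y 0‖ ^ 2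
        + (proxNoise ηx gx gbx x T + proxNoise ηy gy gby y T) := by
    have k1 := mul_le_mul_of_nonneg_left j1 hT0.le
    have k2 := mul_le_mul_of_nonneg_left j2 hT0.le
    rw [mul_inv_cancel_left₀ hT0.ne'] at k1 k2
    rw [hgap]
    linarith
  set N := proxNoise ηx gx gbx x T + proxNoise ηy gy gby y T
  have hN : T * (N / T) = N := mul_div_cancel₀ N hT0.ne'
  have k3 : (1 / ηx + 2 * ρ / 2) * ‖u - x 0‖ ^ 2 ≤ T * (9 / 424 * ρ) * ‖u - x 0‖ ^ 2 :=
    mul_le_mul_of_nonneg_right (by linarith) (by positivity)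
  have k4 : (1 / ηy + 0 / 2) * ‖v - y 0‖ ^ 2 ≤ T * (9 / 424 * lam) * ‖v - y 0‖ ^ 2 :=
    mul_le_mul_of_nonneg_right (by linarith) (by positivity)
  have k5 : saddleGap X Y h xb yb ≤
      9 / 424 * (ρ * ‖u - x 0‖ ^ 2 + lam * ‖v - y 0‖ ^ 2) + N / T := by
    refine le_of_mul_le_mul_left ?_ hT0
    rw [mul_add, hN]
    linarith
  -- With `hclose`, `k5` reads `G₁ ≤ 9/106 (G₀ + G₁) + N / T` for the gaps `G₀` before and `G₁`
  -- after the epoch. Solving gives the factor `9/97 ≤ 1/10` for `G₀` and `106/97` for the noise.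
  linarith

/-- The gap decrease in one epoch controls both the next gap, after recentering, and the distance
of the prox center to the proximal point. -/
lemma saddleGap_recenter_le (W : WeaklyConvexStronglyConcave X Y ρ lam f) {c c' : E} (hc : c ∈ X)
    (hc' : c' ∈ X) {y : F} (hy : y ∈ Y) :
    1 / 10 * saddleGap X Y (regObj (2 * ρ) c' f) c' y
        + 4 / 5 * (primalObj Y f c' - primalObj Y f c)
        + 2 / 5 * (ρ * ‖(saddlePoint X Y (regObj (2 * ρ) c f)).1 - c‖ ^ 2) ≤
      saddleGap X Y (regObj (2 * ρ) c f) c' y := by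
  have H := W.strongConvexConcave_regObj c
  have H' := W.strongConvexConcave_regObj c'
  have hρ := W.pos_left
  have hp := H.isSaddle_saddlePoint
  set p := saddlePoint X Y (regObj (2 * ρ) c f)
  obtain ⟨x, hx, hmin⟩ := H'.exists_isMinOn hy
  have h1 := H.strongConvexOn_primalObj.add_le_of_isMinOn hp.1
    (H.isMinOn_primalObj_of_isSaddle hp) hc
  have h2 := H.saddleGap_nonneg hp.1 hy
  have h3 := (H'.convex y hy).add_le_of_isMinOn hx hmin hc'
  have h4 := H.dualObj_le hx hy
  have h5 := W.le_primalObj hc' hy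
  simp only [saddleGap] at h2 ⊢
  rw [dualObj_eq_of_isMinOn hx hmin]
  rw [W.primalObj_regObj c hc] at h1
  rw [W.primalObj_regObj c' hc', W.primalObj_regObj c hc']
  simp only [sub_self, norm_zero, regObj] at h1 h3 h4 ⊢
  rw [norm_sub_rev c p.1] at h1
  rw [norm_sub_rev c' x] at h3
  -- Let `G` be the right side of the claim and `G'` the recentered gap. Growth at the proximal
  -- point gives `G ≥ P(c') - P(c) + ρ ‖c' - c‖ ^ 2 + ρ/2 ‖p.1 - c‖ ^ 2`. Testing the old dual
  -- objective at `x`, with this bound and `ρ/2 ‖x - c'‖ ^ 2 ≤ G'`, gives `G ≥ G'/2 - 4ρ ‖c' - c‖ ^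
  -- 2`. The weights `4/5` and `1/5` cancel `‖c' - c‖ ^ 2`.
  have h6 : ‖x - c‖ ^ 2 ≤ 5 / 4 * ‖x - c'‖ ^ 2 + 5 * ‖c' - c‖ ^ 2 := by
    have := norm_sub_le_norm_sub_add_norm_sub x c' c
    nlinarith [norm_nonneg (x - c), sq_nonneg (‖x - c'‖ - 4 * ‖c' - c‖)]
  have h7 := mul_le_mul_of_nonneg_left h6 hρ.le
  linarith

/-- The summed pathwise estimate: if the gap decreases in every epoch up to an error `r k`, then the
prox centers are on average close to the proximal points. -/
lemma sum_sq_dist_proximal_le (W : WeaklyConvexStronglyConcave X Y ρ lam f) {c : ℕ → E}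
    {y : ℕ → F} {r : ℕ → ℝ} {ε₀ : ℝ} (hc : ∀ k, c k ∈ X) (hy : ∀ k, y k ∈ Y)
    (hgap : ∀ u ∈ X, ∀ v ∈ Y, f (c 1) v - f u (y 1) ≤ ε₀)
    (hstep : ∀ k, 1 ≤ k → saddleGap X Y (regObj (2 * ρ) (c k) f) (c (k + 1)) (y (k + 1)) ≤
      1 / 10 * saddleGap X Y (regObj (2 * ρ) (c k) f) (c k) (y k) + 106 / 97 * r k) (K : ℕ) :
    2 / 5 * (ρ * ∑ k ∈ Finset.Icc 1 K,
        ‖(saddlePoint X Y (regObj (2 * ρ) (c k) f)).1 - c k‖ ^ 2) ≤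
      9 / 10 * ε₀ + 106 / 97 * ∑ k ∈ Finset.Icc 1 K, r k := by
  have key : 1 / 10 * saddleGap X Y (regObj (2 * ρ) (c (K + 1)) f) (c (K + 1)) (y (K + 1))
      + 4 / 5 * (primalObj Y f (c (K + 1)) - primalObj Y f (c 1))
      + 2 / 5 * (ρ * ∑ k ∈ Finset.Icc 1 K,
        ‖(saddlePoint X Y (regObj (2 * ρ) (c k) f)).1 - c k‖ ^ 2) ≤
      1 / 10 * saddleGap X Y (regObj (2 * ρ) (c 1) f) (c 1) (y 1)
        + 106 / 97 * ∑ k ∈ Finset.Icc 1 K, r k := by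
    induction K with
    | zero => simp
    | succ K ih =>
      rw [Finset.sum_Icc_succ_top (by omega), Finset.sum_Icc_succ_top (by omega)]
      have h1 := hstep (K + 1) (by omega)
      have h2 := W.saddleGap_recenter_le (hc (K + 1)) (hc (K + 1 + 1)) (hy (K + 1 + 1))
      linarith
  have h1 := (W.strongConvexConcave_regObj (c (K + 1))).saddleGap_nonneg (hc (K + 1)) (hy (K + 1))
  have H := W.strongConvexConcave_regObj (c 1)
  obtain ⟨v, hv, hmax⟩ := H.exists_isMaxOn (hc 1)
  obtain ⟨u, hu, hmin⟩ := H.exists_isMinOn (hy 1)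
  have h2 : saddleGap X Y (regObj (2 * ρ) (c 1) f) (c 1) (y 1) ≤ ε₀ := by
    rw [saddleGap, dualObj_eq_of_isMinOn hu hmin, primalObj_eq_of_isMaxOn hv hmax]
    simp only [regObj, sub_self, norm_zero]
    have h3 := hgap u hu v hv
    have h4 : 0 ≤ ρ * ‖u - c 1‖ ^ 2 := mul_nonneg W.pos_left.le (by positivity)
    linarith
  have h3 : primalObj Y f (c 1) - primalObj Y f (c (K + 1)) ≤ ε₀ := by
    have h4 := W.primalObj_regObj (c 1) (hc 1)
    rw [primalObj_eq_of_isMaxOn hv hmax] at h4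
    simp only [regObj, sub_self, norm_zero] at h4
    have h5 := hgap _ (hc (K + 1)) v hv
    have h6 := W.le_primalObj (hc (K + 1)) (hy 1)
    linarith
  linarith

end WeaklyConvexStronglyConcave

end Gap

/-! ### Integrating out an independent variable -/

section Independence

variable {Ω A S : Type*} {mΩ : MeasurableSpace Ω} [MeasurableSpace A] [MeasurableSpace S]
  {μ : Measure Ω} [IsProbabilityMeasure μ] {ν : Measure S} {U : Ω → A} {V : Ω → S}

/-- Conditioning on `U` in Fubini form: the joint law is a product, so `U` can be frozen while `V`
is integrated. -/
lemma ProbabilityTheory.IndepFun.lintegral_comp_prod (h : IndepFun U V μ) (hU : Measurable U)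
    (hV : Measurable V) (hlaw : μ.map V = ν) {φ : A × S → ENNReal} (hφ : Measurable φ) :
    ∫⁻ ω, φ (U ω, V ω) ∂μ = ∫⁻ ω, ∫⁻ s, φ (U ω, s) ∂ν ∂μ := by
  have hprod := (indepFun_iff_map_prod_eq_prod_map_map hU.aemeasurable hV.aemeasurable).1 h
  have : IsProbabilityMeasure (μ.map V) := Measure.isProbabilityMeasure_map hV.aemeasurable
  rw [← lintegral_map hφ (hU.prodMk hV), hprod, lintegral_prod _ hφ.aemeasurable,
    lintegral_map hφ.lintegral_prod_right' hU, hlaw]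

lemma ProbabilityTheory.IndepFun.integral_comp_prod (h : IndepFun U V μ) (hU : Measurable U)
    (hV : Measurable V) (hlaw : μ.map V = ν) {φ : A × S → ℝ} (hφ : Measurable φ)
    (hint : Integrable (fun ω => φ (U ω, V ω)) μ) :
    ∫ ω, φ (U ω, V ω) ∂μ = ∫ ω, ∫ s, φ (U ω, s) ∂ν ∂μ := by
  have hprod := (indepFun_iff_map_prod_eq_prod_map_map hU.aemeasurable hV.aemeasurable).1 h
  have : IsProbabilityMeasure (μ.map V) := Measure.isProbabilityMeasure_map hV.aemeasurable
  have : IsProbabilityMeasure (μ.map U) := Measure.isProbabilityMeasure_map hU.aemeasurable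
  have hi : Integrable φ (μ.map fun ω => (U ω, V ω)) :=
    (integrable_map_measure hφ.aestronglyMeasurable (hU.prodMk hV).aemeasurable).2 hint
  rw [← integral_map (hU.prodMk hV).aemeasurable hφ.aestronglyMeasurable, hprod,
    integral_prod _ (hprod ▸ hi), integral_map hU.aemeasurable, hlaw]
  exact hφ.stronglyMeasurable.integral_prod_right'.aestronglyMeasurable

end Independence

lemma memLp_two_of_lintegral_le {Ω H : Type*} [NormedAddCommGroup H] {mΩ : MeasurableSpace Ω}
    {μ : Measure Ω} {g : Ω → H} (hg : AEStronglyMeasurable g μ) {M : ℝ}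
    (hM : ∫⁻ ω, ‖g ω‖ₑ ^ 2 ∂μ ≤ ENNReal.ofReal (M ^ 2)) :
    MemLp g 2 μ ∧ ∫ ω, ‖g ω‖ ^ 2 ∂μ ≤ M ^ 2 := by
  have he : ∀ ω, ‖g ω‖ₑ ^ 2 = ENNReal.ofReal (‖g ω‖ ^ 2) := fun ω => by
    rw [ENNReal.ofReal_pow (norm_nonneg _), ofReal_norm]
  refine ⟨(memLp_two_iff_integrable_sq_norm hg).2 ⟨hg.norm.pow 2, ?_⟩, ?_⟩
  · rw [hasFiniteIntegral_iff_ofReal (.of_forall fun _ => by positivity)]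
    simp only [← he]
    exact hM.trans_lt ENNReal.ofReal_lt_top
  · rw [integral_eq_lintegral_of_nonneg_ae (.of_forall fun ω => sq_nonneg ‖g ω‖)
      (hg.norm.pow 2)]
    simp only [← he]
    exact ENNReal.toReal_le_of_le_ofReal (sq_nonneg M) hM

lemma MeasureTheory.MemLp.integrable_inner {Ω H : Type*} [NormedAddCommGroup H]
    [InnerProductSpace ℝ H] {mΩ : MeasurableSpace Ω} {μ : Measure Ω} {g h : Ω → H}
    (hg : MemLp g 2 μ) (hh : MemLp h 2 μ) : Integrable (fun ω => (inner ℝ (g ω) (h ω) : ℝ)) μ :=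
  (hg.norm.integrable_mul hh.norm).mono' (hg.1.inner hh.1)
    (.of_forall fun ω => norm_inner_le_norm (g ω) (h ω))

/-! ### Moments and orthogonality of the oracle noise -/

section Oracle

variable {E F H S : Type*}
  [NormedAddCommGroup H] [InnerProductSpace ℝ H] [MeasurableSpace H] [BorelSpace H]
  [SecondCountableTopology H] [CompleteSpace H]
  [MeasurableSpace E] [MeasurableSpace F] [MeasurableSpace S]

/-- A jointly measurable oracle with second moments bounded by `M ^ 2` on `X × Y`. -/
structure BoundedOracle (X : Set E) (Y : Set F) (ν : Measure S) (G : E → F → S → H) (M : ℝ) :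
    Prop where
  meas : Measurable fun p : E × F × S => G p.1 p.2.1 p.2.2
  moment : ∀ x ∈ X, ∀ y ∈ Y, ∫⁻ s, ‖G x y s‖ₑ ^ 2 ∂ν ≤ ENNReal.ofReal (M ^ 2)

namespace BoundedOracle

variable {X : Set E} {Y : Set F} {ν : Measure S} [IsProbabilityMeasure ν] {G : E → F → S → H}
  {M : ℝ}

lemma measurable_section (hG : BoundedOracle X Y ν G M) (x : E) (y : F) :
    Measurable (G x y) :=
  hG.meas.comp (measurable_const.prodMk (measurable_const.prodMk measurable_id))

lemma measurable_mean (hG : BoundedOracle X Y ν G M) :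
    Measurable fun p : E × F => ∫ s, G p.1 p.2 s ∂ν := by
  have : Measurable fun q : (E × F) × S => G q.1.1 q.1.2 q.2 :=
    hG.meas.comp (measurable_fst.fst.prodMk (measurable_fst.snd.prodMk measurable_snd))
  exact this.stronglyMeasurable.integral_prod_right'.measurable

lemma memLp_section (hG : BoundedOracle X Y ν G M) {x : E} (hx : x ∈ X) {y : F} (hy : y ∈ Y) :
    MemLp (G x y) 2 ν :=
  (memLp_two_of_lintegral_le (hG.measurable_section x y).aestronglyMeasurable
    (hG.moment x hx y hy)).1

lemma sq_norm_mean_le (hG : BoundedOracle X Y ν G M) {x : E} (hx : x ∈ X) {y : F} (hy : y ∈ Y) :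
    ‖∫ s, G x y s ∂ν‖ ^ 2 ≤ M ^ 2 := by
  obtain ⟨h1, h2⟩ := memLp_two_of_lintegral_le (hG.measurable_section x y).aestronglyMeasurable
    (hG.moment x hx y hy)
  -- Jensen's inequality for the square, read off from nonnegativity of the variance.
  have h3 : (∫ s, ‖G x y s‖ ∂ν) ^ 2 ≤ ∫ s, ‖G x y s‖ ^ 2 ∂ν := by
    have hv := variance_nonneg (fun s => ‖G x y s‖) ν
    rw [variance_eq_sub h1.norm] at hv
    simpa using hv
  exact (pow_le_pow_left₀ (norm_nonneg _) (norm_integral_le_integral_norm _) 2).trans (h3.trans h2)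

variable {Ω : Type*} {m mΩ : MeasurableSpace Ω} {μ : Measure Ω} [IsProbabilityMeasure μ]
  {U : Ω → E × F} {V : Ω → S}

lemma memLp_comp (hG : BoundedOracle X Y ν G M) (hm : m ≤ mΩ) (hU : Measurable[m] U)
    (hUX : ∀ ω, U ω ∈ X ×ˢ Y) (hV : Measurable V) (hlaw : μ.map V = ν)
    (hind : Indep m (MeasurableSpace.comap V inferInstance) μ) :
    MemLp (fun ω => G (U ω).1 (U ω).2 (V ω)) 2 μ ∧
      ∫ ω, ‖G (U ω).1 (U ω).2 (V ω)‖ ^ 2 ∂μ ≤ M ^ 2 := by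
  have hU' : Measurable U := hU.mono hm le_rfl
  have hUV : IndepFun U V μ := (IndepFun_iff_Indep _ _ _).2
    (indep_of_indep_of_le_left hind hU.comap_le)
  have hGm : Measurable fun q : (E × F) × S => G q.1.1 q.1.2 q.2 :=
    hG.meas.comp (measurable_fst.fst.prodMk (measurable_fst.snd.prodMk measurable_snd))
  have hc : Measurable fun ω => G (U ω).1 (U ω).2 (V ω) := hGm.comp (hU'.prodMk hV)
  refine memLp_two_of_lintegral_le hc.aestronglyMeasurable ?_
  rw [hUV.lintegral_comp_prod hU' hV hlaw (φ := fun q => ‖G q.1.1 q.1.2 q.2‖ₑ ^ 2)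
    (hGm.enorm.pow_const 2)]
  calc ∫⁻ ω, ∫⁻ s, ‖G (U ω).1 (U ω).2 s‖ₑ ^ 2 ∂ν ∂μ
      ≤ ∫⁻ _, ENNReal.ofReal (M ^ 2) ∂μ :=
        lintegral_mono fun ω => hG.moment _ (hUX ω).1 _ (hUX ω).2
    _ = ENNReal.ofReal (M ^ 2) := by simp

lemma memLp_mean_sub (hG : BoundedOracle X Y ν G M) (hm : m ≤ mΩ) (hU : Measurable[m] U)
    (hUX : ∀ ω, U ω ∈ X ×ˢ Y) (hV : Measurable V) (hlaw : μ.map V = ν)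
    (hind : Indep m (MeasurableSpace.comap V inferInstance) μ) :
    MemLp (fun ω => ∫ s, G (U ω).1 (U ω).2 s ∂ν - G (U ω).1 (U ω).2 (V ω)) 2 μ ∧
      ∫ ω, ‖∫ s, G (U ω).1 (U ω).2 s ∂ν - G (U ω).1 (U ω).2 (V ω)‖ ^ 2 ∂μ ≤ 4 * M ^ 2 := by
  have hU' : Measurable U := hU.mono hm le_rfl
  obtain ⟨h1, h2⟩ := hG.memLp_comp hm hU hUX hV hlaw hind
  have h3 : ∀ ω, ‖∫ s, G (U ω).1 (U ω).2 s ∂ν‖ ^ 2 ≤ M ^ 2 := fun ω =>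
    hG.sq_norm_mean_le (hUX ω).1 (hUX ω).2
  have h4 : MemLp (fun ω => ∫ s, G (U ω).1 (U ω).2 s ∂ν) 2 μ :=
    MemLp.of_bound (hG.measurable_mean.comp hU').aestronglyMeasurable |M|
      (.of_forall fun ω => by
        have := Real.sqrt_le_sqrt (h3 ω)
        rwa [Real.sqrt_sq (norm_nonneg _), Real.sqrt_sq_eq_abs] at this)
  refine ⟨h4.sub h1, ?_⟩
  have h5 : Integrable (fun ω => 2 * M ^ 2 + 2 * ‖G (U ω).1 (U ω).2 (V ω)‖ ^ 2) μ :=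
    (integrable_const _).add (h1.integrable_norm_pow (by norm_num) |>.const_mul 2)
  calc _ ≤ ∫ ω, (2 * M ^ 2 + 2 * ‖G (U ω).1 (U ω).2 (V ω)‖ ^ 2) ∂μ := by
        refine integral_mono ((h4.sub h1).integrable_norm_pow (by norm_num)) h5 fun ω => ?_
        have h6 := norm_sub_le (∫ s, G (U ω).1 (U ω).2 s ∂ν) (G (U ω).1 (U ω).2 (V ω))
        have h7 := h3 ω
        nlinarith [norm_nonneg (∫ s, G (U ω).1 (U ω).2 s ∂ν - G (U ω).1 (U ω).2 (V ω)),
          sq_nonneg (‖∫ s, G (U ω).1 (U ω).2 s ∂ν‖ - ‖G (U ω).1 (U ω).2 (V ω)‖)]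
    _ ≤ 4 * M ^ 2 := by
        have h8 : ∫ ω, 2 * ‖G (U ω).1 (U ω).2 (V ω)‖ ^ 2 ∂μ
            = 2 * ∫ ω, ‖G (U ω).1 (U ω).2 (V ω)‖ ^ 2 ∂μ := integral_const_mul _ _
        rw [integral_add (integrable_const _)
          (h1.integrable_norm_pow (by norm_num) |>.const_mul 2), h8]
        simp
        linarith

/-- The martingale difference property: once the query point and `W`, both known before the sample,
are frozen, the error integrates to zero. Square integrability of `W` makes the inner product
integrable. -/
lemma integral_inner_mean_sub_eq_zero (hG : BoundedOracle X Y ν G M) (hm : m ≤ mΩ)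
    (hU : Measurable[m] U) (hUX : ∀ ω, U ω ∈ X ×ˢ Y) (hV : Measurable V) (hlaw : μ.map V = ν)
    (hind : Indep m (MeasurableSpace.comap V inferInstance) μ) {W : Ω → H}
    (hW : Measurable[m] W) (hW2 : MemLp W 2 μ) :
    Integrable (fun ω => inner ℝ
        (∫ s, G (U ω).1 (U ω).2 s ∂ν - G (U ω).1 (U ω).2 (V ω)) (W ω)) μ ∧
      ∫ ω, inner ℝ (∫ s, G (U ω).1 (U ω).2 s ∂ν - G (U ω).1 (U ω).2 (V ω)) (W ω) ∂μ = 0 := by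
  have hint : Integrable (fun ω => inner ℝ
      (∫ s, G (U ω).1 (U ω).2 s ∂ν - G (U ω).1 (U ω).2 (V ω)) (W ω)) μ :=
    MemLp.integrable_inner (hG.memLp_mean_sub hm hU hUX hV hlaw hind).1 hW2
  refine ⟨hint, ?_⟩
  have hUW : Measurable[m] fun ω => (U ω, W ω) := hU.prodMk hW
  have hUV : IndepFun (fun ω => (U ω, W ω)) V μ := (IndepFun_iff_Indep _ _ _).2
    (indep_of_indep_of_le_left hind hUW.comap_le)
  have hGm : Measurable fun q : ((E × F) × H) × S => G q.1.1.1 q.1.1.2 q.2 :=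
    hG.meas.comp (measurable_fst.fst.fst.prodMk (measurable_fst.fst.snd.prodMk measurable_snd))
  have hφ : Measurable fun q : ((E × F) × H) × S =>
      inner ℝ (∫ s, G q.1.1.1 q.1.1.2 s ∂ν - G q.1.1.1 q.1.1.2 q.2) q.1.2 :=
    ((hG.measurable_mean.comp measurable_fst.fst).sub hGm).inner measurable_fst.snd
  rw [hUV.integral_comp_prod (hUW.mono hm le_rfl) hV hlaw hφ hint]
  refine integral_eq_zero_of_ae (.of_forall fun ω => ?_)
  have hi : Integrable (G (U ω).1 (U ω).2) ν :=
    (hG.memLp_section (hUX ω).1 (hUX ω).2).integrable (by norm_num)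
  simp only [Pi.zero_apply]
  simp only [real_inner_comm (W ω)]
  have hi' : Integrable (fun s => ∫ s, G (U ω).1 (U ω).2 s ∂ν - G (U ω).1 (U ω).2 s) ν :=
    (integrable_const _).sub hi
  rw [integral_inner hi', integral_sub (integrable_const _) hi]
  simp

/-- The expected noise of a run of proximal steps. -/
lemma integral_proxNoise_le (hG : BoundedOracle X Y ν G M) {m : ℕ → MeasurableSpace Ω}
    (hmono : Monotone m) (hm : ∀ t, m t ≤ mΩ) {U : ℕ → Ω → E × F} {V : ℕ → Ω → S}
    (hU : ∀ t, Measurable[m t] (U t)) (hUX : ∀ t ω, U t ω ∈ X ×ˢ Y)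
    (hV : ∀ t, Measurable[m (t + 1)] (V t)) (hlaw : ∀ t, μ.map (V t) = ν)
    (hind : ∀ t, Indep (m t) (MeasurableSpace.comap (V t) inferInstance) μ)
    {η : ℝ} (hη : 0 < η) {x : ℕ → Ω → H} (hx : ∀ t, Measurable[m t] (x t))
    (hxstep : ∀ t ω, ‖x (t + 1) ω - x 0 ω‖ ≤
      ‖x t ω - x 0 ω‖ + η * ‖G (U t ω).1 (U t ω).2 (V t ω)‖) (T : ℕ) :
    Integrable (fun ω => proxNoise η (fun t => G (U t ω).1 (U t ω).2 (V t ω))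
        (fun t => ∫ s, G (U t ω).1 (U t ω).2 s ∂ν) (fun t => x t ω) T) μ ∧
      ∫ ω, proxNoise η (fun t => G (U t ω).1 (U t ω).2 (V t ω))
        (fun t => ∫ s, G (U t ω).1 (U t ω).2 s ∂ν) (fun t => x t ω) T ∂μ ≤
      T * (5 / 2 * η * M ^ 2) := by
  have hV' : ∀ t, Measurable (V t) := fun t => (hV t).mono (hm _) le_rfl
  have hg := fun t => hG.memLp_comp (hm t) (hU t) (hUX t) (hV' t) (hlaw t) (hind t)
  have hd := fun t => hG.memLp_mean_sub (hm t) (hU t) (hUX t) (hV' t) (hlaw t) (hind t)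
  have hx0 : ∀ t, Measurable[m t] fun ω => x t ω - x 0 ω := fun t =>
    (hx t).sub ((hx 0).mono (hmono (Nat.zero_le t)) le_rfl)
  have hxL : ∀ t, MemLp (fun ω => x t ω - x 0 ω) 2 μ := by
    intro t
    induction t with
    | zero => simp
    | succ t ih =>
      refine MemLp.of_le (ih.norm.add ((hg t).1.norm.const_mul η))
        ((hx0 (t + 1)).mono (hm _) le_rfl).aestronglyMeasurable (.of_forall fun ω => ?_)
      refine (hxstep t ω).trans ?_
      rw [Real.norm_eq_abs]
      exact le_abs_self _
  have hz := fun t => hG.integral_inner_mean_sub_eq_zero (hm t) (hU t) (hUX t) (hV' t) (hlaw t)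
    (hind t) (hx0 t) (hxL t)
  set D : ℕ → Ω → H := fun t ω =>
    ∫ s, G (U t ω).1 (U t ω).2 s ∂ν - G (U t ω).1 (U t ω).2 (V t ω) with hD
  have hDm : ∀ t, Measurable[m (t + 1)] (D t) := fun t => by
    have hUt : Measurable[m (t + 1)] (U t) := (hU t).mono (hmono (Nat.le_succ t)) le_rfl
    exact (hG.measurable_mean.comp hUt).sub (hG.meas.comp
      ((measurable_fst.comp hUt).prodMk ((measurable_snd.comp hUt).prodMk (hV t))))
  have hSm : ∀ T, Measurable[m T] fun ω => ∑ t ∈ Finset.range T, D t ω := fun T =>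
    Finset.measurable_fun_sum _ fun t ht =>
      (hDm t).mono (hmono (Finset.mem_range.1 ht)) le_rfl
  have hSL : ∀ T, MemLp (fun ω => ∑ t ∈ Finset.range T, D t ω) 2 μ := fun T =>
    memLp_finsetSum _ fun t _ => (hd t).1
  -- Orthogonality: each new error has zero mean inner product with the sum of the earlier ones, so
  -- second moments add up and the bound is linear in `T`.
  have hSq : ∀ T : ℕ, ∫ ω, ‖∑ t ∈ Finset.range T, D t ω‖ ^ 2 ∂μ ≤ T * (4 * M ^ 2) := by
    intro T
    induction T with
    | zero => simp
    | succ T ih =>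
      obtain ⟨i1, i2⟩ := hG.integral_inner_mean_sub_eq_zero (hm T) (hU T) (hUX T) (hV' T) (hlaw T)
        (hind T) (hSm T) (hSL T)
      have e : ∀ ω, ‖∑ t ∈ Finset.range (T + 1), D t ω‖ ^ 2 =
          ‖∑ t ∈ Finset.range T, D t ω‖ ^ 2
            + 2 * inner ℝ (D T ω) (∑ t ∈ Finset.range T, D t ω) + ‖D T ω‖ ^ 2 := fun ω => by
        rw [Finset.sum_range_succ, norm_add_sq_real, real_inner_comm]
      simp only [e]
      have j1 : Integrable (fun ω => ‖∑ t ∈ Finset.range T, D t ω‖ ^ 2) μ :=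
        (hSL T).integrable_norm_pow (by norm_num)
      have j2 : Integrable (fun ω => ‖D T ω‖ ^ 2) μ := (hd T).1.integrable_norm_pow (by norm_num)
      have j3 : Integrable (fun ω => ‖∑ t ∈ Finset.range T, D t ω‖ ^ 2
          + 2 * inner ℝ (D T ω) (∑ t ∈ Finset.range T, D t ω)) μ := j1.add (i1.const_mul 2)
      rw [integral_add j3 j2, integral_add j1 (i1.const_mul 2),
        integral_const_mul, i2]
      have := (hd T).2
      push_cast
      linarith
  have k1 : Integrable (fun ω => η / 2 * ∑ t ∈ Finset.range T,
      ‖G (U t ω).1 (U t ω).2 (V t ω)‖ ^ 2) μ :=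
    (integrable_finsetSum _ fun t _ => (hg t).1.integrable_norm_pow (by norm_num)).const_mul _
  have k2 : Integrable (fun ω => ∑ t ∈ Finset.range T, inner ℝ (D t ω) (x t ω - x 0 ω)) μ :=
    integrable_finsetSum _ fun t _ => (hz t).1
  have k3 : Integrable (fun ω => η / 2 * ‖∑ t ∈ Finset.range T, D t ω‖ ^ 2) μ :=
    ((hSL T).integrable_norm_pow (by norm_num)).const_mul _
  have k4 := k1.add k2
  refine ⟨k4.add k3, ?_⟩
  refine (((integral_add k4 k3).trans (congrArg (· + _) (integral_add k1 k2)))).trans_le ?_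
  rw [integral_const_mul, integral_const_mul,
    integral_finsetSum _ fun t _ => (hg t).1.integrable_norm_pow (by norm_num),
    integral_finsetSum _ fun t _ => (hz t).1, Finset.sum_eq_zero fun t _ => (hz t).2]
  have s1 : ∑ t ∈ Finset.range T, ∫ ω, ‖G (U t ω).1 (U t ω).2 (V t ω)‖ ^ 2 ∂μ ≤ T * M ^ 2 := by
    refine (Finset.sum_le_sum fun t _ => (hg t).2).trans ?_
    simp
  have s2 := mul_le_mul_of_nonneg_left s1 (by positivity : 0 ≤ η / 2)
  have s3 := mul_le_mul_of_nonneg_left (hSq T) (by positivity : 0 ≤ η / 2)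
  linarith

end BoundedOracle

end Oracle

/-! ### The algorithm as proximal steps: feasibility, measurability, gap decrease -/

section Algorithm

variable {E F S : Type*} [NormedAddCommGroup E] [InnerProductSpace ℝ E]
  [NormedAddCommGroup F] [InnerProductSpace ℝ F] {X : Set E} {Y : Set F}
  {Gx : E → F → S → E} {Gy : E → F → S → F} {γ ρ lam : ℝ}

/-- The dual step has no prox term, so its center `c'` is arbitrary: the epoch's start suits the
regret bound, a constant suits measurability. -/
lemma gdaStep_eq_proxStep (ηx ηy : ℝ) (c : E) (c' : F) (p : E × F) (s : S) :
    gdaStep X Y Gx Gy γ ηx ηy c p s =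
      (proxStep X γ ηx c p.1 (Gx p.1 p.2 s), proxStep Y 0 ηy c' p.2 (-Gy p.1 p.2 s)) := by
  simp [gdaStep, proxStep, inner_neg_right]

lemma epochLen_pos (k : ℕ) : 0 < epochLen k := Nat.ceil_pos.2 (by positivity)

lemma le_epochLen (k : ℕ) : 106 * ((k : ℝ) + 1) / 3 ≤ epochLen k := Nat.le_ceil _

variable [ProperSpace E] [ProperSpace F]

lemma epochIter_mem (hXc : IsClosed X) (hX : Convex ℝ X) (hYc : IsClosed Y) (hY : Convex ℝ Y)
    (hγ : 0 ≤ γ) (hρ : 0 < ρ) (hlam : 0 < lam) (k : ℕ) {p : E × F} (hp : p ∈ X ×ˢ Y) (s : ℕ → S)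
    (t : ℕ) : epochIter X Y Gx Gy γ ρ lam k p s t ∈ X ×ˢ Y := by
  cases t with
  | zero => exact hp
  | succ t =>
    rw [epochIter, gdaStep_eq_proxStep (c' := p.2)]
    exact ⟨(proxStep_spec hX hXc ⟨_, hp.1⟩ (by positivity) hγ _ _ _).1,
      (proxStep_spec hY hYc ⟨_, hp.2⟩ (by positivity) le_rfl _ _ _).1⟩

lemma epochStart_mem (hXc : IsClosed X) (hX : Convex ℝ X) (hYc : IsClosed Y) (hY : Convex ℝ Y)
    (hγ : 0 ≤ γ) (hρ : 0 < ρ) (hlam : 0 < lam) {p : E × F} (hp : p ∈ X ×ˢ Y) (s : ℕ → ℕ → S) :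
    ∀ k, epochStart X Y Gx Gy γ ρ lam p s k ∈ X ×ˢ Y
  | 0 => by rwa [epochStart]
  | 1 => by rwa [epochStart]
  | k + 2 => by
    rw [epochStart, Finset.smul_sum]
    have hT : (0 : ℝ) < epochLen (k + 1) := by exact_mod_cast epochLen_pos (k + 1)
    exact (hX.prod hY).sum_mem (fun _ _ => by positivity) (by simp [hT.ne']) fun t _ =>
      epochIter_mem hXc hX hYc hY hγ hρ hlam _
        (epochStart_mem hXc hX hYc hY hγ hρ hlam hp s (k + 1)) _ _

/-- The σ-algebra is explicit and only samples before `t` enter, so that the same statement yields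
adaptedness to the sample history. -/
lemma measurable_epochIter [MeasurableSpace E] [BorelSpace E] [SecondCountableTopology E]
    [MeasurableSpace F] [BorelSpace F] [SecondCountableTopology F] [MeasurableSpace S]
    (hXc : IsClosed X) (hX : Convex ℝ X) (hYc : IsClosed Y) (hY : Convex ℝ Y)
    (hXne : X.Nonempty) (hYne : Y.Nonempty)
    (hγ : 0 ≤ γ) (hρ : 0 < ρ) (hlam : 0 < lam)
    (hGx : Measurable fun p : E × F × S => Gx p.1 p.2.1 p.2.2)
    (hGy : Measurable fun p : E × F × S => Gy p.1 p.2.1 p.2.2) {Ω : Type*} (m : MeasurableSpace Ω)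
    (k : ℕ) {p : Ω → E × F} (hp : Measurable p) {s : ℕ → Ω → S} {t : ℕ}
    (hs : ∀ i < t, Measurable (s i)) :
    Measurable fun ω => epochIter X Y Gx Gy γ ρ lam k (p ω) (fun i => s i ω) t := by
  induction t with
  | zero => exact hp
  | succ t ih =>
    have h1 := ih fun i hi => hs i (by omega)
    have h2 := hs t (by omega)
    simp only [epochIter]
    simp only [gdaStep_eq_proxStep (Y := Y) (c' := (0 : F))]
    have h3 := h1.fst.prodMk (h1.snd.prodMk h2)
    have h4 := h1.fst
    have h5 := h1.snd
    have h6 := hp.fst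
    have h7 := hGx.comp h3
    have h8 := (hGy.comp h3).neg
    set z := fun ω => epochIter X Y Gx Gy γ ρ lam k (p ω) (fun i => s i ω) t
    have hx := (continuous_proxStep (η := 4 / (ρ * ((k : ℝ) + 1))) hX hXc hXne (by positivity)
      hγ).measurable.comp (h6.prodMk (h4.prodMk h7))
    have hy := (continuous_proxStep (η := 2 / (lam * ((k : ℝ) + 1))) hY hYc hYne (by positivity)
      le_rfl).measurable.comp ((measurable_const (a := (0 : F))).prodMk (h5.prodMk h8))
    exact hx.prodMk hy

lemma measurable_epochStart [MeasurableSpace E] [BorelSpace E] [SecondCountableTopology E]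
    [MeasurableSpace F] [BorelSpace F] [SecondCountableTopology F] [MeasurableSpace S]
    (hXc : IsClosed X) (hX : Convex ℝ X) (hYc : IsClosed Y) (hY : Convex ℝ Y)
    (hXne : X.Nonempty) (hYne : Y.Nonempty)
    (hγ : 0 ≤ γ) (hρ : 0 < ρ) (hlam : 0 < lam)
    (hGx : Measurable fun p : E × F × S => Gx p.1 p.2.1 p.2.2)
    (hGy : Measurable fun p : E × F × S => Gy p.1 p.2.1 p.2.2) {Ω : Type*} (m : MeasurableSpace Ω)
    (p : E × F) {s : ℕ → ℕ → Ω → S} :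
    ∀ k, (∀ j < k, ∀ t, Measurable (s j t)) →
      Measurable fun ω => epochStart X Y Gx Gy γ ρ lam p (fun j t => s j t ω) k
  | 0, _ => by simp only [epochStart]; exact measurable_const
  | 1, _ => by simp only [epochStart]; exact measurable_const
  | k + 2, hs => by
    have ih := measurable_epochStart hXc hX hYc hY hXne hYne hγ hρ hlam hGx hGy m p (s := s) (k + 1)
      fun j hj => hs j (by omega)
    simp only [epochStart]
    exact (Finset.measurable_fun_sum _ fun t _ => measurable_epochIter hXc hX hYc hY hXne hYne hγ hρ
      hlam hGx hGy m _ ih fun i _ => hs _ (by omega) i).const_smul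
      ((epochLen (k + 1) : ℝ)⁻¹)

/-- The error of epoch `k` along its iterates `z` and samples `s`. -/
def epochNoise [MeasurableSpace S] (ν : Measure S) (Gx : E → F → S → E) (Gy : E → F → S → F)
    (ρ lam : ℝ) (k : ℕ) (z : ℕ → E × F) (s : ℕ → S) : ℝ :=
  (proxNoise (4 / (ρ * ((k : ℝ) + 1))) (fun t => Gx (z t).1 (z t).2 (s t))
      (fun t => ∫ s, Gx (z t).1 (z t).2 s ∂ν) (fun t => (z t).1) (epochLen k)
    + proxNoise (2 / (lam * ((k : ℝ) + 1))) (fun t => -Gy (z t).1 (z t).2 (s t))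
      (fun t => ∫ s, -Gy (z t).1 (z t).2 s ∂ν) (fun t => (z t).2) (epochLen k)) / epochLen k

/-- Every epoch reduces the duality gap of its regularized problem up to noise, pathwise. -/
lemma WeaklyConvexStronglyConcave.saddleGap_epochStart_succ_le {f : E → F → ℝ}
    (W : WeaklyConvexStronglyConcave X Y ρ lam f) [MeasurableSpace S] {ν : Measure S}
    (hGx : ∀ x ∈ X, ∀ y ∈ Y, (∫ s, Gx x y s ∂ν) ∈ limitingSubdiff X (fun x' => f x' y) x)
    (hGy : ∀ x ∈ X, ∀ y ∈ Y, -(∫ s, Gy x y s ∂ν) ∈ limitingSubdiff Y (fun y' => -f x y') y)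
    {p : E × F} (hp : p ∈ X ×ˢ Y) (s : ℕ → ℕ → S) {k : ℕ} (hk : 1 ≤ k) :
    saddleGap X Y (regObj (2 * ρ) (epochStart X Y Gx Gy (2 * ρ) ρ lam p s k).1 f)
        (epochStart X Y Gx Gy (2 * ρ) ρ lam p s (k + 1)).1
        (epochStart X Y Gx Gy (2 * ρ) ρ lam p s (k + 1)).2 ≤
      1 / 10 * saddleGap X Y (regObj (2 * ρ) (epochStart X Y Gx Gy (2 * ρ) ρ lam p s k).1 f)
        (epochStart X Y Gx Gy (2 * ρ) ρ lam p s k).1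
        (epochStart X Y Gx Gy (2 * ρ) ρ lam p s k).2
      + 106 / 97 * epochNoise ν Gx Gy ρ lam k (epochIter X Y Gx Gy (2 * ρ) ρ lam k
          (epochStart X Y Gx Gy (2 * ρ) ρ lam p s k) (s k)) (s k) := by
  have hρ := W.pos_left
  have hlam := W.pos_right
  have hmem := epochStart_mem (Gx := Gx) (Gy := Gy) W.closed_left W.convex_left W.closed_right
    W.convex_right (by positivity : 0 ≤ 2 * ρ) hρ hlam hp s k
  obtain ⟨j, rfl⟩ : ∃ j, k = j + 1 := ⟨k - 1, by omega⟩
  rw [epochStart]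
  set q := epochStart X Y Gx Gy (2 * ρ) ρ lam p s (j + 1)
  set z := epochIter X Y Gx Gy (2 * ρ) ρ lam (j + 1) q (s (j + 1)) with hz
  have hzmem : ∀ t, z t ∈ X ×ˢ Y := fun t => epochIter_mem W.closed_left W.convex_left
    W.closed_right W.convex_right (by positivity) hρ hlam _ hmem _ t
  have hstep : ∀ t, z (t + 1) = _ := fun t =>
    (by rw [hz, epochIter] : z (t + 1) = _).trans
      (gdaStep_eq_proxStep _ _ q.1 q.2 (z t) (s (j + 1) t))
  have hlen := le_epochLen (j + 1)
  have hj : (0 : ℝ) ≤ j := Nat.cast_nonneg j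
  push_cast at hlen
  have h := W.saddleGap_average_le (x := fun t => (z t).1) (y := fun t => (z t).2)
    (gx := fun t => Gx (z t).1 (z t).2 (s (j + 1) t))
    (gy := fun t => -Gy (z t).1 (z t).2 (s (j + 1) t))
    (gbx := fun t => ∫ s, Gx (z t).1 (z t).2 s ∂ν) (gby := fun t => ∫ s, -Gy (z t).1 (z t).2 s ∂ν)
    (ηx := 4 / (ρ * (((j + 1 : ℕ) : ℝ) + 1))) (ηy := 2 / (lam * (((j + 1 : ℕ) : ℝ) + 1)))
    (by positivity) (by positivity) (epochLen_pos (j + 1)) (fun t => (hzmem t).1)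
    (fun t => (hzmem t).2) (fun t => congrArg Prod.fst (hstep t))
    (fun t => congrArg Prod.snd (hstep t))
    (fun t u hu => (W.weaklyConvex _ (hzmem t).2).le_of_mem_limitingSubdiff hρ.le
      (hGx _ (hzmem t).1 _ (hzmem t).2) hu)
    (fun t u hu => by
      have hconv : WeaklyConvexOn Y 0 fun y => -f (z t).1 y := by
        have : ConvexOn ℝ Y fun y => -f (z t).1 y := ((W.concave _ (hzmem t).1).concaveOn fun r => by
          simp only [Pi.zero_apply]; positivity).neg
        simpa [WeaklyConvexOn] using this
      have := hconv.le_of_mem_limitingSubdiff le_rfl (hGy _ (hzmem t).1 _ (hzmem t).2) hu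
      rw [integral_neg]
      simpa using this)
    -- With `k = j + 1`, the left side is `ρ (k + 5) / 4` and the right side is at least `3/4 ρ (k +
    -- 1)`. These agree at `k = 1`, which is what the factor `106/3` in the epoch length is for.
    (by
      rw [one_div_div]
      push_cast
      nlinarith)
    (by
      rw [one_div_div]
      push_cast
      nlinarith)
  simpa only [Prod.smul_fst, Prod.smul_snd, Prod.fst_sum, Prod.snd_sum, epochNoise] using! h

end Algorithm

/-! ### The filtration of the samples -/

section Samples

/-- The σ-algebra generated by the samples drawn before step `t` of epoch `k`. -/
@[reducible]
def sampleHistory {Ω S : Type*} [MeasurableSpace S] (ξ : ℕ → ℕ → Ω → S) (k t : ℕ) :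
    MeasurableSpace Ω :=
  ⨆ p ∈ {p : ℕ × ℕ | p.1 < k ∨ (p.1 = k ∧ p.2 < t)}, MeasurableSpace.comap (ξ p.1 p.2) inferInstance

variable {Ω S : Type*} [MeasurableSpace S] {ξ : ℕ → ℕ → Ω → S}

lemma sampleHistory_mono (k : ℕ) : Monotone (sampleHistory ξ k) := fun _ _ h =>
  biSup_mono fun _ hp => hp.imp_right fun hp => ⟨hp.1, hp.2.trans_le h⟩

lemma measurable_sampleHistory {j i k t : ℕ} (h : j < k ∨ (j = k ∧ i < t)) :
    Measurable[sampleHistory ξ k t] (ξ j i) := by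
  have : MeasurableSpace.comap (ξ j i) inferInstance ≤ sampleHistory ξ k t :=
    le_biSup (fun p : ℕ × ℕ => MeasurableSpace.comap (ξ p.1 p.2) inferInstance)
      (i := (j, i)) (by exact h)
  exact (comap_measurable (ξ j i)).mono this le_rfl

variable {mΩ : MeasurableSpace Ω}

lemma sampleHistory_le (hξ : ∀ k t, Measurable (ξ k t)) (k t : ℕ) : sampleHistory ξ k t ≤ mΩ :=
  iSup₂_le fun _ _ => (hξ _ _).comap_le

/-- The history and the fresh sample are generated by disjoint blocks of an independent family. -/
lemma indep_sampleHistory {μ : Measure Ω} (hξ : ∀ k t, Measurable (ξ k t))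
    (hind : iIndepFun (fun p : ℕ × ℕ => ξ p.1 p.2) μ) (k t : ℕ) :
    Indep (sampleHistory ξ k t) (MeasurableSpace.comap (ξ k t) inferInstance) μ := by
  have h := indep_iSup_of_disjoint (m := fun p : ℕ × ℕ =>
    MeasurableSpace.comap (ξ p.1 p.2) inferInstance) (fun p => (hξ p.1 p.2).comap_le) hind.iIndep
    (S := {p : ℕ × ℕ | p.1 < k ∨ (p.1 = k ∧ p.2 < t)}) (T := {(k, t)}) (by simp)
  simpa [sampleHistory] using h

end Samples

/-! ### Expected noise of an epoch -/

section Expectation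

variable {E F S Ω : Type*} [NormedAddCommGroup E] [InnerProductSpace ℝ E]
  [NormedAddCommGroup F] [InnerProductSpace ℝ F] [ProperSpace E] [ProperSpace F]
  [MeasurableSpace E] [BorelSpace E] [SecondCountableTopology E]
  [MeasurableSpace F] [BorelSpace F] [SecondCountableTopology F] [MeasurableSpace S]
  {mΩ : MeasurableSpace Ω} {μ : Measure Ω} [IsProbabilityMeasure μ]
  {ν : Measure S} [IsProbabilityMeasure ν] {X : Set E} {Y : Set F}
  {Gx : E → F → S → E} {Gy : E → F → S → F} {γ ρ lam M₁ M₂ : ℝ}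

lemma BoundedOracle.neg {H : Type*} [NormedAddCommGroup H] [MeasurableSpace H] [BorelSpace H]
    {G : E → F → S → H} {M : ℝ} (hG : BoundedOracle X Y ν G M) :
    BoundedOracle X Y ν (fun x y s => -G x y s) M :=
  ⟨hG.meas.neg, by simpa using hG.moment⟩

/-- Each player contributes `5/2 η M ^ 2`. The primal step size has numerator `4` and the dual one
`2`, whence the weights of `M₁ ^ 2 / ρ` and `M₂ ^ 2 / lam`. -/
lemma integral_epochNoise_le (hXc : IsClosed X) (hX : Convex ℝ X) (hYc : IsClosed Y)
    (hY : Convex ℝ Y) (hγ : 0 ≤ γ) (hρ : 0 < ρ) (hlam : 0 < lam)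
    (hGx : BoundedOracle X Y ν Gx M₁) (hGy : BoundedOracle X Y ν Gy M₂)
    {ξ : ℕ → ℕ → Ω → S} (hξ : ∀ k t, Measurable (ξ k t)) (hlaw : ∀ k t, μ.map (ξ k t) = ν)
    (hind : iIndepFun (fun p : ℕ × ℕ => ξ p.1 p.2) μ) {p : E × F} (hp : p ∈ X ×ˢ Y) (k : ℕ) :
    Integrable (fun ω => epochNoise ν Gx Gy ρ lam k (epochIter X Y Gx Gy γ ρ lam k
        (epochStart X Y Gx Gy γ ρ lam p (fun j t => ξ j t ω) k) (fun t => ξ k t ω))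
        (fun t => ξ k t ω)) μ ∧
      ∫ ω, epochNoise ν Gx Gy ρ lam k (epochIter X Y Gx Gy γ ρ lam k
        (epochStart X Y Gx Gy γ ρ lam p (fun j t => ξ j t ω) k) (fun t => ξ k t ω))
        (fun t => ξ k t ω) ∂μ ≤ 5 * (2 * M₁ ^ 2 / ρ + M₂ ^ 2 / lam) * (1 / ((k : ℝ) + 1)) := by
  set q : Ω → E × F := fun ω => epochStart X Y Gx Gy γ ρ lam p (fun j t => ξ j t ω) k with hq
  set z : ℕ → Ω → E × F := fun t ω =>
    epochIter X Y Gx Gy γ ρ lam k (q ω) (fun t => ξ k t ω) t with hz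
  have hqmem : ∀ ω, q ω ∈ X ×ˢ Y := fun ω => epochStart_mem hXc hX hYc hY hγ hρ hlam hp _ k
  have hzmem : ∀ t ω, z t ω ∈ X ×ˢ Y := fun t ω =>
    epochIter_mem hXc hX hYc hY hγ hρ hlam k (hqmem ω) _ t
  have hXne : X.Nonempty := ⟨_, hp.1⟩
  have hYne : Y.Nonempty := ⟨_, hp.2⟩
  have hzm : ∀ t, Measurable[sampleHistory ξ k t] (z t) := fun t =>
    measurable_epochIter hXc hX hYc hY hXne hYne hγ hρ hlam hGx.meas hGy.meas
      (sampleHistory ξ k t) k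
      (measurable_epochStart hXc hX hYc hY hXne hYne hγ hρ hlam hGx.meas hGy.meas
        (sampleHistory ξ k t) p k fun j hj i => measurable_sampleHistory (.inl hj))
      fun i hi => measurable_sampleHistory (.inr ⟨rfl, hi⟩)
  have hstep : ∀ t ω, z (t + 1) ω = _ := fun t ω =>
    gdaStep_eq_proxStep _ _ (q ω).1 (q ω).2 (z t ω) (ξ k t ω)
  have hx := hGx.integral_proxNoise_le (m := sampleHistory ξ k) (U := z) (V := ξ k)
    (η := 4 / (ρ * ((k : ℝ) + 1))) (x := fun t ω => (z t ω).1) (sampleHistory_mono k)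
    (sampleHistory_le hξ k) hzm hzmem (fun t => measurable_sampleHistory (.inr ⟨rfl, by omega⟩))
    (hlaw k) (indep_sampleHistory hξ hind k) (by positivity)
    (fun t => measurable_fst.comp (hzm t)) (fun t ω => by
      rw [hstep]
      exact norm_proxStep_sub_center_le hX hXc (by positivity) hγ (hqmem ω).1 _ _) (epochLen k)
  have hy := hGy.neg.integral_proxNoise_le (m := sampleHistory ξ k) (U := z) (V := ξ k)
    (η := 2 / (lam * ((k : ℝ) + 1))) (x := fun t ω => (z t ω).2) (sampleHistory_mono k)
    (sampleHistory_le hξ k) hzm hzmem (fun t => measurable_sampleHistory (.inr ⟨rfl, by omega⟩))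
    (hlaw k) (indep_sampleHistory hξ hind k) (by positivity)
    (fun t => measurable_snd.comp (hzm t)) (fun t ω => by
      rw [hstep]
      exact norm_proxStep_sub_center_le hY hYc (by positivity) le_rfl (hqmem ω).2 _ _) (epochLen k)
  have hT : (0 : ℝ) < epochLen k := by exact_mod_cast epochLen_pos k
  refine ⟨(hx.1.add hy.1).div_const _, ?_⟩
  refine ((integral_div _ _).trans (congrArg (· / _) (integral_add hx.1 hy.1))).trans_le ?_
  rw [div_le_iff₀ hT]
  refine (add_le_add hx.2 hy.2).trans_eq ?_
  field_simp
  ring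

end Expectation

/-! ### Number of epochs and total iteration count -/

section EpochCount

lemma sum_one_div_succ_le_log (K : ℕ) :
    ∑ k ∈ Finset.Icc 1 K, 1 / ((k : ℝ) + 1) ≤ Real.log ((K : ℝ) + 1) := by
  induction K with
  | zero => simp
  | succ K ih =>
    rw [Finset.sum_Icc_succ_top (by omega)]
    push_cast
    have h1 : (0 : ℝ) < (K : ℝ) + 1 := by positivity
    have h2 : (0 : ℝ) < (K : ℝ) + 1 + 1 := by positivity
    have h3 := Real.log_le_sub_one_of_pos (div_pos h1 h2)
    rw [Real.log_div h1.ne' h2.ne'] at h3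
    have h4 : ((K : ℝ) + 1) / ((K : ℝ) + 1 + 1) - 1 = -(1 / ((K : ℝ) + 1 + 1)) := by
      field_simp; ring
    linarith

/-- `a ∑ 1 / (k + 1)` is of order `K` as soon as `K ≥ a log a`. -/
lemma mul_sum_one_div_succ_le {a : ℝ} (ha : 0 ≤ a) {K : ℕ} (hK : 1 ≤ K)
    (haK : a * Real.log a ≤ K) : a * ∑ k ∈ Finset.Icc 1 K, 1 / ((k : ℝ) + 1) ≤ 4 * K := by
  have hK1 : (1 : ℝ) ≤ K := by exact_mod_cast hK
  rcases le_total a 1 with h | h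
  · have h1 : ∑ k ∈ Finset.Icc 1 K, 1 / ((k : ℝ) + 1) ≤ K := by
      refine (Finset.sum_le_card_nsmul _ _ 1 fun k _ => ?_).trans ?_
      · rw [div_le_one (by positivity)]
        linarith [Nat.cast_nonneg (α := ℝ) k]
      · simp
    have h2 : 0 ≤ ∑ k ∈ Finset.Icc 1 K, 1 / ((k : ℝ) + 1) :=
      Finset.sum_nonneg fun k _ => by positivity
    nlinarith
  · have ha0 : 0 < a := by linarith
    have h1 := sum_one_div_succ_le_log K
    -- This is `log u ≤ u - 1` at `u = (K + 1) / a ^ 2`. After multiplication by `a`, each of the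
    -- two terms is at most `2K`: the first by `a log a ≤ K`, the second by `a ≥ 1`.
    have h2 : Real.log ((K : ℝ) + 1) ≤ 2 * Real.log a + ((K : ℝ) + 1) / a ^ 2 := by
      have h3 := Real.log_le_sub_one_of_pos
        (show 0 < ((K : ℝ) + 1) / a ^ 2 by positivity)
      rw [Real.log_div (by positivity) (by positivity), Real.log_pow] at h3
      push_cast at h3
      linarith
    have h4 : a * (((K : ℝ) + 1) / a ^ 2) ≤ 2 * K := by
      rw [show a * (((K : ℝ) + 1) / a ^ 2) = ((K : ℝ) + 1) / a by field_simp,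
        div_le_iff₀ ha0]
      nlinarith
    have h5 := mul_le_mul_of_nonneg_left (h1.trans h2) ha0.le
    linarith

lemma one_le_numEpochs (γ ρ lam M₁ M₂ ε₀ ε : ℝ) : 1 ≤ numEpochs γ ρ lam M₁ M₂ ε₀ ε :=
  le_max_left _ _

/-- Since `γ = 2ρ`, the prefactor `γ ^ 2 * 5 / (2ρ)` equals `5γ`. The two parts of `epochBound` then
leave ample room: the initial gap uses less than `ε ^ 2 / 60` and the noise less than `ε ^ 2 / 15`.
-/
lemma average_bound_le {γ ρ lam M₁ M₂ ε₀ ε : ℝ} (hρ : 0 < ρ) (hlam : 0 < lam) (hγ : γ = 2 * ρ)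
    (hε : 0 < ε) {K : ℕ} (hK : numEpochs γ ρ lam M₁ M₂ ε₀ ε ≤ K) :
    γ ^ 2 * (1 / (K : ℝ) * (5 / (2 * ρ) * (9 / 10 * ε₀ + 106 / 97 * ∑ k ∈ Finset.Icc 1 K,
      5 * (2 * M₁ ^ 2 / ρ + M₂ ^ 2 / lam) * (1 / ((k : ℝ) + 1))))) ≤ ε ^ 2 := by
  have hγ0 : 0 < γ := by rw [hγ]; positivity
  have hK1 : 1 ≤ K := (one_le_numEpochs ..).trans hK
  have hK0 : (0 : ℝ) < K := by exact_mod_cast hK1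
  have hbound : epochBound γ ρ lam M₁ M₂ ε₀ ε ≤ K :=
    (Nat.le_ceil _).trans (by exact_mod_cast (le_max_right _ _).trans hK)
  rw [epochBound, max_le_iff] at hbound
  rw [← Finset.mul_sum]
  set C := 2 * M₁ ^ 2 / ρ + M₂ ^ 2 / lam with hC
  have hC0 : 0 ≤ C := by positivity
  obtain ⟨h1, h2⟩ := hbound
  have h3 := mul_sum_one_div_succ_le (a := 1696 * γ * C / ε ^ 2) (by positivity) hK1 h1
  set H := ∑ k ∈ Finset.Icc 1 K, 1 / ((k : ℝ) + 1)
  rw [div_le_iff₀ (by positivity)] at h2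
  rw [div_mul_eq_mul_div, div_le_iff₀ (by positivity)] at h3
  have h4 : γ ^ 2 * (1 / (K : ℝ) * (5 / (2 * ρ) * (9 / 10 * ε₀ + 106 / 97 * (5 * C * H))))
      = (9 / 2 * (γ * ε₀) + 2650 / 97 * (γ * C * H)) / K := by
    rw [hγ]; field_simp; ring
  rw [h4, div_le_iff₀ hK0]
  have h5 : 0 ≤ K * ε ^ 2 := by positivity
  nlinarith

lemma epochLen_le {k : ℕ} (hk : 1 ≤ k) : (epochLen k : ℝ) ≤ 74 * k := by
  have h := (Nat.ceil_lt_add_one (by positivity : 0 ≤ 106 * ((k : ℝ) + 1) / 3)).le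
  have hk' : (1 : ℝ) ≤ k := by exact_mod_cast hk
  unfold epochLen
  linarith

lemma sum_epochLen_le (K : ℕ) : ((∑ k ∈ Finset.Icc 1 K, epochLen k : ℕ) : ℝ) ≤ 74 * (K : ℝ) ^ 2 := by
  push_cast
  refine (Finset.sum_le_card_nsmul _ _ (74 * (K : ℝ)) fun k hk => ?_).trans ?_
  · rw [Finset.mem_Icc] at hk
    refine (epochLen_le hk.1).trans ?_
    have : (k : ℝ) ≤ K := by exact_mod_cast hk.2
    linarith
  · rw [Nat.card_Icc, nsmul_eq_mul]
    simp only [Nat.add_sub_cancel]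
    exact le_of_eq (by ring)

/-- The number of epochs is `O(ε⁻² log(1/ε))`, because `log(A / ε ^ 2) = log A + 2 log(1/ε)`, and
the iteration count is at most quadratic in it. -/
lemma sum_epochLen_numEpochs_isBigO {γ ρ lam M₁ M₂ ε₀ : ℝ} (hρ : 0 < ρ) (hlam : 0 < lam)
    (hγ : 0 < γ) (hε₀ : 0 < ε₀) :
    (fun ε : ℝ => ((∑ k ∈ Finset.Icc 1 (numEpochs γ ρ lam M₁ M₂ ε₀ ε), epochLen k : ℕ) : ℝ))
      =O[𝓝[>] 0] fun ε : ℝ => 1 / ε ^ 4 * Real.log (1 / ε) ^ 2 := by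
  set A := 1696 * γ * (2 * M₁ ^ 2 / ρ + M₂ ^ 2 / lam) with hA
  have hA0 : 0 ≤ A := by positivity
  -- The sum dominates both entries of the maximum; the final `2` absorbs the rounding up and the
  -- minimum of one epoch.
  set Q := A * (|Real.log A| + 2) + 1376 * γ * ε₀ / 5 + 2 with hQ
  refine Asymptotics.IsBigO.of_bound (74 * Q ^ 2) ?_
  -- For `ε < exp (-1)` both `log (1 / ε)` and `1 / ε ^ 2` are at least one, so constants are
  -- absorbed into their product.
  filter_upwards [Ioo_mem_nhdsGT (Real.exp_pos (-1))] with ε hε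
  have hε0 : 0 < ε := hε.1
  have hL : 1 ≤ Real.log (1 / ε) := by
    rw [Real.le_log_iff_exp_le (by positivity), le_div_iff₀ hε0]
    calc Real.exp 1 * ε ≤ Real.exp 1 * Real.exp (-1) :=
          mul_le_mul_of_nonneg_left hε.2.le (Real.exp_pos 1).le
      _ = 1 := by rw [← Real.exp_add]; simp
  set L := Real.log (1 / ε) with hLdef
  have hε1 : 1 ≤ 1 / ε ^ 2 := by
    rw [le_div_iff₀ (by positivity), one_mul]
    have : ε < 1 := hε.2.trans (by
      rw [← Real.exp_zero]; exact Real.exp_lt_exp.2 (by norm_num))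
    nlinarith
  set e := 1 / ε ^ 2 with he
  have hb1 : A / ε ^ 2 * Real.log (A / ε ^ 2) ≤ A * (|Real.log A| + 2) * (e * L) := by
    rcases hA0.eq_or_lt with h | h
    · simp [← h]
    · have h1 : Real.log (A / ε ^ 2) = Real.log A + 2 * L := by
        rw [Real.log_div h.ne' (by positivity), Real.log_pow, hLdef, one_div, Real.log_inv]
        push_cast; ring
      have h2 : Real.log A + 2 * L ≤ (|Real.log A| + 2) * L := by
        nlinarith [le_abs_self (Real.log A), abs_nonneg (Real.log A)]
      calc A / ε ^ 2 * Real.log (A / ε ^ 2) = A * e * (Real.log A + 2 * L) := by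
            rw [h1, he]; ring
        _ ≤ A * e * ((|Real.log A| + 2) * L) := mul_le_mul_of_nonneg_left h2 (by positivity)
        _ = A * (|Real.log A| + 2) * (e * L) := by ring
  have heL : 1 ≤ e * L := one_le_mul_of_one_le_of_one_le hε1 hL
  have heL' : e ≤ e * L := le_mul_of_one_le_right (by positivity) hL
  have hb2 : 1376 * γ * ε₀ / (5 * ε ^ 2) ≤ 1376 * γ * ε₀ / 5 * (e * L) := by
    calc 1376 * γ * ε₀ / (5 * ε ^ 2) = 1376 * γ * ε₀ / 5 * e := by rw [he]; field_simp
      _ ≤ _ := mul_le_mul_of_nonneg_left heL' (by positivity)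
  have hc1 : 0 ≤ A * (|Real.log A| + 2) * (e * L) := by positivity
  have hc2 : 0 ≤ 1376 * γ * ε₀ / 5 * (e * L) := by positivity
  have hN : (numEpochs γ ρ lam M₁ M₂ ε₀ ε : ℝ) ≤ Q * (e * L) := by
    have hb : epochBound γ ρ lam M₁ M₂ ε₀ ε ≤ (Q - 2) * (e * L) := by
      rw [epochBound, hQ]
      refine max_le ?_ ?_
      · refine hb1.trans ?_
        linarith
      · refine hb2.trans ?_
        linarith
    unfold numEpochs
    rw [Nat.cast_max, max_le_iff]
    have hQ2 : 0 ≤ (Q - 2) * (e * L) := by rw [hQ]; linarith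
    refine ⟨by push_cast; linarith, ?_⟩
    have := (Nat.ceil_mono hb).trans_eq rfl
    have h3 : ((⌈epochBound γ ρ lam M₁ M₂ ε₀ ε⌉₊ : ℕ) : ℝ) ≤ ⌈(Q - 2) * (e * L)⌉₊ := by
      exact_mod_cast this
    have h4 := Nat.ceil_lt_add_one hQ2
    linarith
  rw [Real.norm_of_nonneg (Nat.cast_nonneg _), Real.norm_of_nonneg (by positivity)]
  refine (sum_epochLen_le _).trans ?_
  have h5 : 1 / ε ^ 4 = e ^ 2 := by rw [he]; field_simp
  rw [h5]
  calc 74 * (numEpochs γ ρ lam M₁ M₂ ε₀ ε : ℝ) ^ 2 ≤ 74 * (Q * (e * L)) ^ 2 := by gcongr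
    _ = 74 * Q ^ 2 * (e ^ 2 * L ^ 2) := by ring

end EpochCount

/-! ### Evaluation at an independent uniform epoch -/

section RandomEpoch

lemma lintegral_uniformOn_Icc (K : ℕ) (g : ℕ → ENNReal) :
    ∫⁻ k, g k ∂(uniformOn (Set.Icc 1 K)) = (K : ENNReal)⁻¹ * ∑ k ∈ Finset.Icc 1 K, g k := by
  rw [uniformOn, ProbabilityTheory.cond, lintegral_smul_measure, ← Finset.coe_Icc, lintegral_finset,
    Measure.count_apply_finset]
  simp

variable {Ω A : Type*} {mΩ : MeasurableSpace Ω} [MeasurableSpace A] {μ : Measure Ω}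
  [IsProbabilityMeasure μ] {τ : Ω → ℕ} {Ξ : Ω → A} {K : ℕ}

/-- `Ξ` stands for the whole sample array: freezing it and integrating over `τ` alone produces the
average over epochs. -/
lemma lintegral_comp_uniform (hτ : Measurable τ) (hlaw : μ.map τ = uniformOn (Set.Icc 1 K))
    (hΞ : Measurable Ξ) (hind : IndepFun τ Ξ μ) {h : ℕ → A → ENNReal} (hh : ∀ k, Measurable (h k)) :
    ∫⁻ ω, h (τ ω) (Ξ ω) ∂μ = (K : ENNReal)⁻¹ * ∑ k ∈ Finset.Icc 1 K, ∫⁻ ω, h k (Ξ ω) ∂μ := by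
  rw [hind.symm.lintegral_comp_prod hΞ hτ hlaw (φ := fun q => h q.2 q.1)
    (measurable_from_prod_countable_left fun k => hh k)]
  simp only [lintegral_uniformOn_Icc]
  have hm : ∀ k, Measurable fun ω => h k (Ξ ω) := fun k => (hh k).comp hΞ
  rw [lintegral_const_mul _ (Finset.measurable_fun_sum _ fun k _ => hm k),
    lintegral_finsetSum _ fun k _ => hm k]

lemma measurable_comp_countable {B : Type*} [MeasurableSpace B] (hτ : Measurable τ)
    (hΞ : Measurable Ξ) {h : ℕ → A → B} (hh : ∀ k, Measurable (h k)) :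
    Measurable fun ω => h (τ ω) (Ξ ω) :=
  (measurable_from_prod_countable_left (f := fun q : A × ℕ => h q.2 q.1) hh).comp (hΞ.prodMk hτ)

end RandomEpoch

lemma sub_le_of_dualityGap_le {E F : Type*} {X : Set E} {Y : Set F} {f : E → F → ℝ} {x₀ : E}
    {y₀ : F} {ε₀ : ℝ} (h : dualityGap X Y f x₀ y₀ ≤ (ε₀ : EReal)) {x : E} (hx : x ∈ X) {y : F}
    (hy : y ∈ Y) : f x₀ y - f x y₀ ≤ ε₀ := by
  have h1 : ((f x₀ y - f x y₀ : ℝ) : EReal) ≤ ε₀ := by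
    rw [EReal.coe_sub]
    exact (EReal.sub_le_sub (le_iSup₂ (f := fun y' (_ : y' ∈ Y) => (f x₀ y' : EReal)) y hy)
      (iInf₂_le (f := fun x' (_ : x' ∈ X) => (f x' y₀ : EReal)) x hx)).trans h
  exact_mod_cast h1

/-! ### Assembling the expectation bound -/

section Main

variable {E F S Ω : Type*} [NormedAddCommGroup E] [InnerProductSpace ℝ E]
  [NormedAddCommGroup F] [InnerProductSpace ℝ F] [ProperSpace E] [ProperSpace F]
  [MeasurableSpace E] [BorelSpace E] [SecondCountableTopology E]
  [MeasurableSpace F] [BorelSpace F] [SecondCountableTopology F] [MeasurableSpace S]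
  {mΩ : MeasurableSpace Ω} {μ : Measure Ω} [IsProbabilityMeasure μ]
  {ν : Measure S} [IsProbabilityMeasure ν] {X : Set E} {Y : Set F}
  {Gx : E → F → S → E} {Gy : E → F → S → F} {ρ lam M₁ M₂ : ℝ}

/-- The summed expected squared distances of the prox centers to the proximal points. -/
lemma WeaklyConvexStronglyConcave.sum_lintegral_sq_dist_le {f : E → F → ℝ}
    (W : WeaklyConvexStronglyConcave X Y ρ lam f)
    (hGx_sub : ∀ x ∈ X, ∀ y ∈ Y, (∫ s, Gx x y s ∂ν) ∈ limitingSubdiff X (fun x' => f x' y) x)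
    (hGy_sub : ∀ x ∈ X, ∀ y ∈ Y, -(∫ s, Gy x y s ∂ν) ∈ limitingSubdiff Y (fun y' => -f x y') y)
    (hGx : BoundedOracle X Y ν Gx M₁) (hGy : BoundedOracle X Y ν Gy M₂)
    {ξ : ℕ → ℕ → Ω → S} (hξ : ∀ k t, Measurable (ξ k t)) (hlaw : ∀ k t, μ.map (ξ k t) = ν)
    (hind : iIndepFun (fun p : ℕ × ℕ => ξ p.1 p.2) μ) {x₀ : E} {y₀ : F} (hx₀ : x₀ ∈ X)
    (hy₀ : y₀ ∈ Y) {ε₀ : ℝ} (hgap : dualityGap X Y f x₀ y₀ ≤ (ε₀ : EReal))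
    {xs : ℕ → Ω → E} (hxs : ∀ k ω, xs k ω =
      (epochStart X Y Gx Gy (2 * ρ) ρ lam (x₀, y₀) (fun j t => ξ j t ω) k).1)
    (hxs_meas : ∀ k, Measurable (xs k)) (K : ℕ) :
    ∑ k ∈ Finset.Icc 1 K, ∫⁻ ω,
        ‖(saddlePoint X Y (regObj (2 * ρ) (xs k ω) f)).1 - xs k ω‖ₑ ^ 2 ∂μ ≤
      ENNReal.ofReal (5 / (2 * ρ) * (9 / 10 * ε₀ + 106 / 97 * ∑ k ∈ Finset.Icc 1 K,
        5 * (2 * M₁ ^ 2 / ρ + M₂ ^ 2 / lam) * (1 / ((k : ℝ) + 1)))) := by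
  have hρ := W.pos_left
  have hp : (x₀, y₀) ∈ X ×ˢ Y := ⟨hx₀, hy₀⟩
  set r : ℕ → Ω → ℝ := fun k ω => epochNoise ν Gx Gy ρ lam k
    (epochIter X Y Gx Gy (2 * ρ) ρ lam k
      (epochStart X Y Gx Gy (2 * ρ) ρ lam (x₀, y₀) (fun j t => ξ j t ω) k) (fun t => ξ k t ω))
    (fun t => ξ k t ω)
  have hr : ∀ k, Integrable (r k) μ ∧
      ∫ ω, r k ω ∂μ ≤ 5 * (2 * M₁ ^ 2 / ρ + M₂ ^ 2 / lam) * (1 / ((k : ℝ) + 1)) :=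
    integral_epochNoise_le W.closed_left W.convex_left W.closed_right W.convex_right
      (by positivity) hρ W.pos_right hGx hGy hξ hlaw hind hp
  -- The telescoped bound holds for each `ω` separately; `5 / (2ρ)` inverts its factor `2/5 ρ`.
  -- Expectations are taken only afterwards.
  have hpath : ∀ ω, ∑ k ∈ Finset.Icc 1 K,
      ‖(saddlePoint X Y (regObj (2 * ρ) (xs k ω) f)).1 - xs k ω‖ ^ 2 ≤
      5 / (2 * ρ) * (9 / 10 * ε₀ + 106 / 97 * ∑ k ∈ Finset.Icc 1 K, r k ω) := by
    intro ω
    have hmem := epochStart_mem (Gx := Gx) (Gy := Gy) W.closed_left W.convex_left W.closed_right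
      W.convex_right (by positivity : 0 ≤ 2 * ρ) hρ W.pos_right hp (fun j t => ξ j t ω)
    have h := W.sum_sq_dist_proximal_le (r := fun k => r k ω) (fun k => (hmem k).1)
      (fun k => (hmem k).2) (ε₀ := ε₀)
      (fun u hu v hv => by
        simp only [epochStart]
        exact sub_le_of_dualityGap_le hgap hu hv)
      (fun k hk => W.saddleGap_epochStart_succ_le hGx_sub hGy_sub hp (fun j t => ξ j t ω) hk) K
    simp only [← hxs] at h
    rw [div_mul_eq_mul_div, le_div_iff₀ (by positivity)]
    linarith
  have hint : Integrable (fun ω => 5 / (2 * ρ) * (9 / 10 * ε₀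
      + 106 / 97 * ∑ k ∈ Finset.Icc 1 K, r k ω)) μ :=
    ((integrable_const _).add
      ((integrable_finsetSum _ fun k _ => (hr k).1).const_mul _)).const_mul _
  have hval : ∫ ω, 5 / (2 * ρ) * (9 / 10 * ε₀ + 106 / 97 * ∑ k ∈ Finset.Icc 1 K, r k ω) ∂μ
      = 5 / (2 * ρ) * (9 / 10 * ε₀ + 106 / 97 * ∑ k ∈ Finset.Icc 1 K, ∫ ω, r k ω ∂μ) := by
    have hsum : ∫ ω, 106 / 97 * ∑ k ∈ Finset.Icc 1 K, r k ω ∂μ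
        = 106 / 97 * ∫ ω, ∑ k ∈ Finset.Icc 1 K, r k ω ∂μ := integral_const_mul _ _
    rw [integral_const_mul, integral_add (integrable_const _)
      ((integrable_finsetSum _ fun k _ => (hr k).1).const_mul _), hsum,
      integral_finsetSum _ fun k _ => (hr k).1]
    simp
  have hmeas : ∀ k, Measurable fun ω =>
      ‖(saddlePoint X Y (regObj (2 * ρ) (xs k ω) f)).1 - xs k ω‖ₑ ^ 2 := fun k =>
    (((W.continuous_saddlePoint_fst.measurable.comp (hxs_meas k)).sub
      (hxs_meas k)).enorm).pow_const 2
  rw [← lintegral_finsetSum _ fun k _ => hmeas k]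
  calc ∫⁻ ω, ∑ k ∈ Finset.Icc 1 K,
        ‖(saddlePoint X Y (regObj (2 * ρ) (xs k ω) f)).1 - xs k ω‖ₑ ^ 2 ∂μ
      ≤ ∫⁻ ω, ENNReal.ofReal
          (5 / (2 * ρ) * (9 / 10 * ε₀ + 106 / 97 * ∑ k ∈ Finset.Icc 1 K, r k ω)) ∂μ := by
        refine lintegral_mono fun ω => ?_
        refine le_trans (le_of_eq ?_) (ENNReal.ofReal_le_ofReal (hpath ω))
        rw [ENNReal.ofReal_sum_of_nonneg fun k _ => by positivity]
        refine Finset.sum_congr rfl fun k _ => ?_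
        rw [ENNReal.ofReal_pow (norm_nonneg _), ofReal_norm]
    _ = ENNReal.ofReal (5 / (2 * ρ) * (9 / 10 * ε₀
          + 106 / 97 * ∑ k ∈ Finset.Icc 1 K, ∫ ω, r k ω ∂μ)) := by
        rw [← hval, ofReal_integral_eq_lintegral_ofReal hint (.of_forall fun ω =>
          (Finset.sum_nonneg fun k _ => by positivity).trans (hpath ω))]
    _ ≤ _ := by
        refine ENNReal.ofReal_le_ofReal ?_
        have := Finset.sum_le_sum fun k (_ : k ∈ Finset.Icc 1 K) => (hr k).2
        gcongr

end Main

end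

theorem theorem2 {d n : ℕ}
    (X : Set (EuclideanSpace ℝ (Fin d))) (Y : Set (EuclideanSpace ℝ (Fin n)))
    (hXc : IsClosed X) (hXconv : Convex ℝ X) (hYc : IsClosed Y) (hYconv : Convex ℝ Y)
    (f : EuclideanSpace ℝ (Fin d) → EuclideanSpace ℝ (Fin n) → ℝ)
    (hf : ContinuousOn (fun p : EuclideanSpace ℝ (Fin d) × EuclideanSpace ℝ (Fin n) => f p.1 p.2)
      (X ×ˢ Y))
    (ρ lam γ : ℝ) (hρ : 0 < ρ) (hlam : 0 < lam) (hγ : γ = 2 * ρ)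
    (hwc : ∀ y ∈ Y, WeaklyConvexOn X ρ fun x => f x y)
    (hsc : ∀ x ∈ X, StrongConcaveOn Y lam fun y => f x y)
    -- the stochastic subgradient oracle
    {S : Type*} [MeasurableSpace S] (ν : Measure S) [IsProbabilityMeasure ν]
    (Gx : EuclideanSpace ℝ (Fin d) → EuclideanSpace ℝ (Fin n) → S → EuclideanSpace ℝ (Fin d))
    (Gy : EuclideanSpace ℝ (Fin d) → EuclideanSpace ℝ (Fin n) → S → EuclideanSpace ℝ (Fin n))
    (hGx_meas : Measurable
      fun p : EuclideanSpace ℝ (Fin d) × EuclideanSpace ℝ (Fin n) × S => Gx p.1 p.2.1 p.2.2)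
    (hGy_meas : Measurable
      fun p : EuclideanSpace ℝ (Fin d) × EuclideanSpace ℝ (Fin n) × S => Gy p.1 p.2.1 p.2.2)
    (hGx_sub : ∀ x ∈ X, ∀ y ∈ Y, (∫ s, Gx x y s ∂ν) ∈ limitingSubdiff X (fun x' => f x' y) x)
    (hGy_sub : ∀ x ∈ X, ∀ y ∈ Y, -(∫ s, Gy x y s ∂ν) ∈ limitingSubdiff Y (fun y' => -f x y') y)
    (M₁ M₂ : ℝ)
    (hGx_mom : ∀ x ∈ X, ∀ y ∈ Y, ∫⁻ s, ‖Gx x y s‖ₑ ^ 2 ∂ν ≤ ENNReal.ofReal (M₁ ^ 2))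
    (hGy_mom : ∀ x ∈ X, ∀ y ∈ Y, ∫⁻ s, ‖Gy x y s‖ₑ ^ 2 ∂ν ≤ ENNReal.ofReal (M₂ ^ 2))
    -- the initial solution and its duality gap
    (x₀ : EuclideanSpace ℝ (Fin d)) (y₀ : EuclideanSpace ℝ (Fin n)) (hx₀ : x₀ ∈ X) (hy₀ : y₀ ∈ Y)
    (ε₀ : ℝ) (hε₀ : 0 < ε₀) (hgap : dualityGap X Y f x₀ y₀ ≤ (ε₀ : EReal))
    -- independent samples drawn from the oracle's distribution
    {Ω : Type*} [MeasurableSpace Ω] (μ : Measure Ω) [IsProbabilityMeasure μ]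
    (ξ : ℕ → ℕ → Ω → S) (hξ_meas : ∀ k t, Measurable (ξ k t))
    (hξ_law : ∀ k t, μ.map (ξ k t) = ν)
    (hξ_indep : iIndepFun (fun p : ℕ × ℕ => ξ p.1 p.2) μ)
    -- the epoch starting points and the saddle points of the regularized problems
    (xs : ℕ → Ω → EuclideanSpace ℝ (Fin d))
    (hxs : ∀ k ω, xs k ω =
      (epochStart X Y Gx Gy γ ρ lam (x₀, y₀) (fun j t => ξ j t ω) k).1)
    (xhat : ℕ → Ω → EuclideanSpace ℝ (Fin d))
    (hxhat : ∀ k ω, xhat k ω = (saddlePoint X Y (regObj γ (xs k ω) f)).1) :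
    -- the regularized problems do have unique saddle points
    (∀ k, 1 ≤ k → ∀ ω, ∃! p, IsSaddle X Y (regObj γ (xs k ω) f) p) ∧
    -- convergence for a uniformly random epoch
    (∀ ε : ℝ, 0 < ε → ∀ K : ℕ, numEpochs γ ρ lam M₁ M₂ ε₀ ε ≤ K →
      ∀ τ : Ω → ℕ, Measurable τ → μ.map τ = uniformOn (Set.Icc 1 K) →
        IndepFun τ (fun ω (p : ℕ × ℕ) => ξ p.1 p.2 ω) μ →
        (∫⁻ ω, Metric.infEDist 0
              (limitingSubdiff X (primalObj Y f) (xhat (τ ω) ω)) ^ 2 ∂μ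
            ≤ ENNReal.ofReal (γ ^ 2) * ∫⁻ ω, ‖xhat (τ ω) ω - xs (τ ω) ω‖ₑ ^ 2 ∂μ) ∧
        (ENNReal.ofReal (γ ^ 2) * ∫⁻ ω, ‖xhat (τ ω) ω - xs (τ ω) ω‖ₑ ^ 2 ∂μ
            ≤ ENNReal.ofReal (ε ^ 2)) ∧
        NearlyStationaryInMean μ X (primalObj Y f) (1 / γ) ε (fun ω => xs (τ ω) ω)) ∧
    -- the total number of iterations is of order `ε⁻⁴` up to logarithmic factors
    (fun ε : ℝ => ((∑ k ∈ Finset.Icc 1 (numEpochs γ ρ lam M₁ M₂ ε₀ ε), epochLen k : ℕ) : ℝ))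
      =O[𝓝[>] 0] fun ε : ℝ => 1 / ε ^ 4 * Real.log (1 / ε) ^ 2 := by
  subst hγ
  have W : WeaklyConvexStronglyConcave X Y ρ lam f :=
    ⟨hXc, hYc, ⟨x₀, hx₀⟩, ⟨y₀, hy₀⟩, hρ, hlam, hwc, hsc, hf⟩
  refine ⟨fun k _ ω => (W.strongConvexConcave_regObj _).existsUnique_isSaddle, ?_,
    sum_epochLen_numEpochs_isBigO hρ hlam (by positivity) hε₀⟩
  intro ε hε K hK τ hτ hτlaw hτind
  set Ξ : Ω → ℕ × ℕ → S := fun ω p => ξ p.1 p.2 ω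
  have hΞ : Measurable Ξ := measurable_pi_lambda _ fun p => hξ_meas p.1 p.2
  -- Each prox center is a fixed measurable function of the sample array, so independence of `τ`
  -- from the array is all that the random epoch needs.
  set Ψ : ℕ → (ℕ × ℕ → S) → EuclideanSpace ℝ (Fin d) := fun k s =>
    (epochStart X Y Gx Gy (2 * ρ) ρ lam (x₀, y₀) (fun j t => s (j, t)) k).1
  have hΨ : ∀ k, Measurable (Ψ k) := fun k =>
    (measurable_epochStart hXc hXconv hYc hYconv ⟨x₀, hx₀⟩ ⟨y₀, hy₀⟩ (by positivity) hρ hlam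
      hGx_meas hGy_meas inferInstance (x₀, y₀) (s := fun j t (s : ℕ × ℕ → S) => s (j, t)) k
      fun j _ t => measurable_pi_apply (j, t)).fst
  have hxsΨ : ∀ k ω, xs k ω = Ψ k (Ξ ω) := hxs
  have hxs_meas : ∀ k, Measurable (xs k) := fun k => by
    rw [show xs k = Ψ k ∘ Ξ from funext (hxsΨ k)]
    exact (hΨ k).comp hΞ
  have hprox := W.continuous_saddlePoint_fst.measurable
  set prox : EuclideanSpace ℝ (Fin d) → EuclideanSpace ℝ (Fin d) := fun c =>
    (saddlePoint X Y (regObj (2 * ρ) c f)).1 with hprox_def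
  have hxhat' : ∀ k ω, xhat k ω = prox (xs k ω) := hxhat
  have hK1 : 1 ≤ K := (one_le_numEpochs ..).trans hK
  have hK0 : (0 : ℝ) < K := by exact_mod_cast hK1
  have hρ2 : 0 < 2 * ρ := by positivity
  have hfirst : ∫⁻ ω, Metric.infEDist 0
      (limitingSubdiff X (primalObj Y f) (xhat (τ ω) ω)) ^ 2 ∂μ ≤
      ENNReal.ofReal ((2 * ρ) ^ 2) * ∫⁻ ω, ‖xhat (τ ω) ω - xs (τ ω) ω‖ₑ ^ 2 ∂μ := by
    rw [← lintegral_const_mul' _ _ ENNReal.ofReal_ne_top]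
    refine lintegral_mono fun ω => ?_
    rw [hxhat', ENNReal.ofReal_pow hρ2.le, ← mul_pow]
    exact pow_le_pow_left' (W.infEDist_limitingSubdiff_le _) 2
  have hsum := W.sum_lintegral_sq_dist_le hGx_sub hGy_sub ⟨hGx_meas, hGx_mom⟩ ⟨hGy_meas, hGy_mom⟩
    hξ_meas hξ_law hξ_indep hx₀ hy₀ hgap hxs hxs_meas K
  have havg : ∫⁻ ω, ‖xhat (τ ω) ω - xs (τ ω) ω‖ₑ ^ 2 ∂μ =
      (K : ENNReal)⁻¹ * ∑ k ∈ Finset.Icc 1 K, ∫⁻ ω, ‖prox (xs k ω) - xs k ω‖ₑ ^ 2 ∂μ := by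
    simp only [hxhat', hxsΨ]
    exact lintegral_comp_uniform hτ hτlaw hΞ hτind
      (h := fun k s => ‖prox (Ψ k s) - Ψ k s‖ₑ ^ 2)
      fun k => (((hprox.comp (hΨ k)).sub (hΨ k)).enorm).pow_const 2
  have hsecond : ENNReal.ofReal ((2 * ρ) ^ 2) *
      ∫⁻ ω, ‖xhat (τ ω) ω - xs (τ ω) ω‖ₑ ^ 2 ∂μ ≤ ENNReal.ofReal (ε ^ 2) := by
    rw [havg]
    refine (mul_le_mul_right (mul_le_mul_right hsum _) _).trans ?_
    rw [← ENNReal.ofReal_natCast, ← ENNReal.ofReal_inv_of_pos hK0,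
      ← ENNReal.ofReal_mul (by positivity), ← ENNReal.ofReal_mul (by positivity), ← one_div]
    exact ENNReal.ofReal_le_ofReal (average_bound_le hρ hlam rfl hε hK)
  refine ⟨hfirst, hsecond, fun ω => xhat (τ ω) ω, ?_, ?_, hfirst.trans hsecond⟩
  · simp only [hxhat', hxsΨ]
    exact measurable_comp_countable hτ hΞ fun k => hprox.comp (hΨ k)
  -- The witness is the proximal point of the random epoch; its distance bound is `hsecond` divided
  -- by `γ ^ 2`.
  · have hne : ENNReal.ofReal ((2 * ρ) ^ 2) ≠ 0 := by simpa using by positivity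
    rw [← ENNReal.mul_le_mul_iff_right hne ENNReal.ofReal_ne_top]
    refine hsecond.trans_eq ?_
    rw [← ENNReal.ofReal_mul (by positivity)]
    congr 1
    field_simp
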